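/- Let $d=2n$ be a positive even integer, write $\mathbf z=(\mathbf x,\mathbf y)\in\mathbb R^{n}\times\mathbb R^{n}=\mathbb R^d$, and set $F_0(\mathbf z)=\mathbf x\cdot\mathbf y=\tfrac12A_0\mathbf z\cdot\mathbf z$ with $A_0(\mathbf x,\mathbf y)=(\mathbf y,\mathbf x)$. For $m\in\mathbb R$ let $\Sigma_m=\{\mathbf z: F_0(\mathbf z)=m\}$ and $$\sigma_\infty(F_0,w,m)=\int_{\Sigma_m}w(\mathbf z)\,|A_0\mathbf z|^{-1}\,d\mathbf z|_{\Sigma_m},$$ where $d\mathbf z|_{\Sigma_m}$ is the Euclidean volume element ($(d-1)$-dimensional surface measure) of $\Sigma_m$. Let $w_0(x)=\exp\big(\tfrac1{x^2-1}\big)$ for $|x|<1$ and $w_0(x)=0$ otherwise, $c_0=\int_{\mathbb R}w_0$, $\omega(x)=\tfrac4{c_0}w_0(4x-3)$, and for $x>0$, $y\in\mathbb R$ $$h(x,y)=\sum_{j\ge1}\frac1{xj}\,\omega(xj)-\sum_{j\ge1}\frac1{xj}\,\omega\Big(\frac{|y|}{xj}\Big).$$ For real $L>1$ and an integer $q\ge1$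 put $$I_q(0)=\int_{\mathbb R^d}w\Big(\frac{\mathbf z}L\Big)\,h\Big(\frac qL,\frac{F_0(\mathbf z)-mL^2}{L^2}\Big)\,d\mathbf z .$$ Finally let $\|f\|_{a,b}=\sup_{\mathbf z}\max_{|\alpha|\le a}|\partial^\alpha f(\mathbf z)|\,\max\{1,|\mathbf z|\}^{b}$. Let $M\ge1$ be an integer, $C>0$ and $\gamma_1>0$. Consider real functions $w\in C^M(\mathbb R^d)$ with $\|w\|_{M,d-1}<\infty$ and $\|w\|_{0,d+1}<\infty$, real $L>1$ and integers $1\le q\le CL$. All constants in $O(\cdot)$ below are independent of $w$, $L$, $q$. (i) If $M<d/2-1$, then $$I_q(0)=L^d\sigma_\infty(F_0,w,m)+O\Big(q^ML^{d-M+\gamma_1}\big(\|w\|_{M,d-1}+\|w\|_{0,d+1}\big)\Big),$$ where the constant depends only on $M,C,\gamma_1,d$ and $m$, uniformly for $m$ in compact intervals. (ii) If $M=d/2-1$ and $m\ne0$, then $$I_q(0)=L^d\sigma_\infty(F_0,w,m)+\max\{1,|\log|m||\}\;O\Big(q^ML^{d-M+\gamma_1}\big(\|w\|_{M,d-1}+\|w\|_{0,d+1}\big)\Big),$$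 where the constant depends only on $C,\gamma_1,d$ and $m$, uniformly for nonzero $m$ in bounded intervals (including those that contain or approach $0$). (iii) If $M=d/2-1$ and $m=0$, then $$I_q(0)=L^d\sigma_\infty(F_0,w,0)+O\Big(q^ML^{d-M+\gamma_1}\big(\|w\|_{M,d-1}\,|\log(q/L)|+\|w\|_{0,d+1}\big)\Big),$$ where the constant depends only on $C,\gamma_1,d$. -/

import Mathlib

open MeasureTheory

open scoped ENNReal

noncomputable section

namespace CircleMethod

/-- The space `ℝ^d` with `d = 2 n`, with its Euclidean norm and Lebesgue measure. A point is
`z = (x, y)`, where `x i = z (Sum.inl i)` and `y i = z (Sum.inr i)`. -/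
abbrev Sp (n : ℕ) : Type := EuclideanSpace ℝ (Fin n ⊕ Fin n)

/-- The quadratic form `F₀(x, y) = x · y`. -/
def F0 {n : ℕ} (z : Sp n) : ℝ := ∑ i : Fin n, z (Sum.inl i) * z (Sum.inr i)

/-- The symmetric operator `A₀(x, y) = (y, x)`. -/
def A0 {n : ℕ} (z : Sp n) : Sp n := WithLp.toLp 2 (fun i => z i.swap)

/-- `F₀` is the quadratic form of `A₀`. -/
theorem F0_eq_inner {n : ℕ} (z : Sp n) : F0 z = (1 / 2 : ℝ) * inner ℝ (A0 z) z := by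
  simp only [F0, A0, PiLp.inner_apply, Fintype.sum_sum_type, Sum.swap_inl, Sum.swap_inr,
    RCLike.inner_apply, conj_trivial]
  rw [Finset.sum_congr rfl (fun (i : Fin n) _ => mul_comm (z (Sum.inr i)) (z (Sum.inl i)))]
  ring

/-- The quadric `Σ_t = {z : F₀(z) = t}`. -/
def quadric (n : ℕ) (t : ℝ) : Set (Sp n) := {z | F0 z - t = 0}

/-- The singular integral `σ_∞(F₀, w, m) = ∫_{Σ_m} w(z) |A₀ z|⁻¹ dz|_{Σ_m}`. The volume element
of the hypersurface `Σ_m` (and of `Σ_0 \ {0}`) is the Euclidean `(d-1)`-dimensional Hausdorff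
measure, normalised to agree with Lebesgue measure on `ℝ^(d-1)`. -/
def sigmaInf (n : ℕ) (w : Sp n → ℝ) (m : ℝ) : ℝ :=
  ∫ z in quadric n m, w z * ‖A0 z‖⁻¹ ∂(Measure.euclideanHausdorffMeasure (2 * n - 1))

/-- The bump function `w₀`. -/
def w0 (x : ℝ) : ℝ := if |x| < 1 then Real.exp (1 / (x ^ 2 - 1)) else 0

/-- The constant `c₀ = ∫ w₀`. -/
def c0 : ℝ := ∫ x : ℝ, w0 x

/-- The shifted weight `ω`, supported on `[1/2, 1]`. -/
def omega (x : ℝ) : ℝ := 4 / c0 * w0 (4 * x - 3)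

/-- The function `h(x, y) = ∑_{j ≥ 1} (x j)⁻¹ (ω(x j) - ω(|y| / (x j)))`, used for `x > 0`;
each of the two sums has finitely many non-zero terms. -/
def hFun (x y : ℝ) : ℝ :=
  (∑' j : ℕ+, 1 / (x * (j : ℝ)) * omega (x * (j : ℝ))) -
    ∑' j : ℕ+, 1 / (x * (j : ℝ)) * omega (|y| / (x * (j : ℝ)))

/-- `e_q(x) = exp(2πi x / q)`. -/
def expQ (q : ℕ) (x : ℝ) : ℂ := Complex.exp (2 * Real.pi * Complex.I * x / q)

/-- `I_q(c) = ∫ w(z/L) h(q/L, (F₀(z) - m L²)/L²) e_q(-z·c) dz`. -/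
def Iq {n : ℕ} (w : Sp n → ℝ) (m L : ℝ) (q : ℕ) (c : Fin n ⊕ Fin n → ℤ) : ℂ :=
  ∫ z : Sp n, ((w (L⁻¹ • z) * hFun (q / L) ((F0 z - m * L ^ 2) / L ^ 2) : ℝ) : ℂ) *
    expQ q (-∑ i, z i * (c i : ℝ))

/-- The (extended-valued) norm `‖f‖_{a,b} = sup_z max_{|α| ≤ a} |∂^α f(z)| ⟨z⟩^b`, where
`⟨z⟩ = max {1, |z|}`; the partial derivatives of order `k` are indexed by the `k` coordinate
directions in which one differentiates. -/
def wnorm {n : ℕ} (a : ℕ) (b : ℝ) (f : Sp n → ℝ) : ℝ≥0∞ :=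
  ⨆ (z : Sp n) (k : ℕ) (_ : k ≤ a) (j : Fin k → Fin n ⊕ Fin n),
    ENNReal.ofReal
      (|iteratedFDeriv ℝ k f z (fun i => EuclideanSpace.single (j i) (1 : ℝ))| *
        (max 1 ‖z‖) ^ b)

end CircleMethod

end

noncomputable section

namespace CircleMethod

open Set Filter Topology
open scoped ContDiff SchwartzMap FourierTransform

/-! Rescaling `z` by `L` turns `I_q(0)` into `L^d ∫ w(z) h(X, F₀(z) - m) dz` with `X = q/L`. The
claim is thus that `h(X, ·)` acts as a Dirac mass, with an error of size `X^M` up to an arbitrarily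
small power.

One-dimensional part. After rescaling, both sums in `h` are Riemann sums with the same main term
`kappa / X`. Poisson summation therefore concentrates `h(X, y)` on `|y| ≲ X` up to `O(X^N)`
(`exists_hFun_bound`), and shows that its moments over `[-1, 1]` are those of a Dirac mass up to
`O(X^N)` (`exists_moment_bound`). A Taylor expansion of fractional order `p` then gives
`exists_kernel_bound`: a test function whose derivatives of order `k` are at most `A^k B` is
evaluated at `0` with error about `X^p B (1 + A^p)`, plus a tail term.

Geometric part. `F₀` is affine in `y i` with slope `x i`, so over `{x i ≠ 0}` the level sets are
graphs, and raising the level by `r` translates `y i` by `r / x i`. By the area formula and `‖A₀ z‖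
= ‖z‖`, both Lebesgue measure and `σ_∞` have density `|x i|⁻¹` in these charts. The error is then an
integral over the chart of kernel errors with `A = |x i|⁻¹`.

Convergence. A partition of unity that damps `x i` where it is small relative to the other `x j`
reduces the weight `|x i|^(-1-p)` to one no worse than `|x|^(-1-p)` on `ℝⁿ`, which is integrable at
the origin when `1 + p < n` (`integrable_weight`). Taking `p` slightly below `M` admits every `M ≤
d/2 - 1`, endpoint included, uniformly in `m`; the lost power of `X` is absorbed by `L^γ₁`
(`exists_norm_Iq_sub_le`). Cases (i) and (ii) follow at once. Case (iii) needs care only where `log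
(q/L)` may be small, and there a crude bound by `‖w‖_{0,d+1}` suffices
(`exists_norm_Iq_sub_le_of_half_lt`). -/

/-! ### The bump function and the weight `ω`. -/

theorem w0_eq_expNegInvGlue (x : ℝ) : w0 x = expNegInvGlue (1 - x ^ 2) := by
  unfold w0 expNegInvGlue
  have h : |x| < 1 ↔ ¬ (1 - x ^ 2 ≤ 0) := by
    rw [not_le, sub_pos, sq_lt_one_iff_abs_lt_one]
  by_cases hx : |x| < 1
  · rw [if_pos hx, if_neg (h.1 hx), one_div, ← inv_neg, neg_sub]
  · rw [if_neg hx, if_pos (not_not.1 (mt h.2 hx))]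

theorem contDiff_w0 : ContDiff ℝ ∞ w0 := by
  have : w0 = fun x => expNegInvGlue (1 - x ^ 2) := funext w0_eq_expNegInvGlue
  rw [this]
  exact expNegInvGlue.contDiff.comp (by fun_prop)

theorem w0_nonneg (x : ℝ) : 0 ≤ w0 x := by
  rw [w0_eq_expNegInvGlue]; exact expNegInvGlue.nonneg _

theorem w0_eq_zero {x : ℝ} (hx : 1 ≤ |x|) : w0 x = 0 := if_neg (not_lt.2 hx)

theorem hasCompactSupport_w0 : HasCompactSupport w0 := by
  refine HasCompactSupport.intro (isCompact_Icc (a := (-1 : ℝ)) (b := 1)) fun x hx => ?_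
  refine w0_eq_zero ?_
  by_contra h
  exact hx (abs_le.1 (not_le.1 h).le)

theorem c0_pos : 0 < c0 := by
  refine (contDiff_w0.continuous.integral_pos_of_hasCompactSupport_nonneg_nonzero
    hasCompactSupport_w0 w0_nonneg (x := 0) ?_)
  simp [w0]

theorem contDiff_omega : ContDiff ℝ ∞ omega := by
  unfold omega
  exact contDiff_const.mul (contDiff_w0.comp (by fun_prop))

theorem omega_nonneg (x : ℝ) : 0 ≤ omega x :=
  mul_nonneg (div_nonneg (by norm_num) c0_pos.le) (w0_nonneg _)

theorem omega_of_le_half {x : ℝ} (hx : x ≤ 1 / 2) : omega x = 0 := by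
  rw [omega, w0_eq_zero, mul_zero]
  rw [abs_of_nonpos (by linarith)]; linarith

theorem omega_of_one_le {x : ℝ} (hx : 1 ≤ x) : omega x = 0 := by
  rw [omega, w0_eq_zero, mul_zero]
  rw [abs_of_nonneg (by linarith)]; linarith

theorem hasCompactSupport_omega : HasCompactSupport omega := by
  refine HasCompactSupport.intro (isCompact_Icc (a := (0 : ℝ)) (b := 1)) fun x hx => ?_
  by_contra h
  refine hx ⟨?_, ?_⟩
  · by_contra h'; exact h (omega_of_le_half (by linarith))
  · by_contra h'; exact h (omega_of_one_le (by linarith))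

theorem integral_omega : ∫ x, omega x = 1 := by
  have h : ∫ x : ℝ, w0 (4 * x - 3) = (1 / 4) * c0 := by
    have h1 := Measure.integral_comp_mul_left (fun y => w0 (y - 3)) (4 : ℝ)
    rw [h1, integral_sub_right_eq_self (fun y => w0 y) (3 : ℝ), c0, smul_eq_mul]
    norm_num
  unfold omega
  rw [integral_const_mul, h]
  field_simp [c0_pos.ne']

/-! ### Poisson summation for Riemann sums. -/

/-- Poisson summation: Riemann sums of a smooth compactly supported function converge to its
integral faster than any power of the mesh. -/
theorem exists_riemannSum_bound {g : ℝ → ℝ} (hg : ContDiff ℝ ∞ g) (hc : HasCompactSupport g)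
    {N : ℕ} (hN : 2 ≤ N) :
    ∃ K : ℝ, 0 ≤ K ∧ ∀ X : ℝ, 0 < X → |X * ∑' j : ℤ, g (X * j) - ∫ x, g x| ≤ K * X ^ N := by
  have hgc : ContDiff ℝ ∞ (fun x => (g x : ℂ)) := Complex.ofRealCLM.contDiff.comp hg
  have hcc : HasCompactSupport (fun x => (g x : ℂ)) := hc.comp_left (g := Complex.ofReal) rfl
  let G : 𝓢(ℝ, ℂ) := hcc.toSchwartzMap hgc
  have hGapp : ∀ x, G x = (g x : ℂ) := fun x => rfl
  obtain ⟨K, hKpos, hK⟩ := (𝓕 G).decay N 0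
  simp only [norm_iteratedFDeriv_zero] at hK
  have hK0 : 0 ≤ K := hKpos.le
  -- The zero frequency contributes `1 / 0 = 0`, in agreement with the sequence `b` below, from
  -- which it is removed. Convergence is where `2 ≤ N` enters.
  have hsum : Summable fun j : ℤ => 1 / |(j : ℝ)| ^ N := by
    have := Real.summable_one_div_int_pow (p := N) |>.2 (by omega)
    simpa [abs_pow, abs_div] using this.abs
  refine ⟨K * ∑' j : ℤ, 1 / |(j : ℝ)| ^ N,
    mul_nonneg hK0 (tsum_nonneg fun j => by positivity), fun X hX => ?_⟩
  have hX' : X ≠ 0 := hX.ne'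
  have hgX : ContDiff ℝ ∞ (fun x => (g (X * x) : ℂ)) := hgc.comp (by fun_prop)
  have hcX : HasCompactSupport (fun x => (g (X * x) : ℂ)) := by
    have := hcc.comp_homeomorph (Homeomorph.mulLeft₀ X hX')
    exact this
  let H : 𝓢(ℝ, ℂ) := hcX.toSchwartzMap hgX
  have hHapp : ∀ x, H x = (g (X * x) : ℂ) := fun x => rfl
  have hF : ∀ ξ : ℝ, 𝓕 H ξ = ((X⁻¹ : ℝ) : ℂ) * 𝓕 G (ξ / X) := by
    intro ξ
    rw [SchwartzMap.fourier_coe, SchwartzMap.fourier_coe, Real.fourier_real_eq,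
      Real.fourier_real_eq]
    have h1 := Measure.integral_comp_mul_left
      (fun v => Real.fourierChar (-(v * (ξ / X))) • G v) X
    rw [abs_of_pos (inv_pos.2 hX)] at h1
    rw [← Complex.real_smul, ← h1]
    refine integral_congr_ae (Eventually.of_forall fun v => ?_)
    simp only [hGapp, hHapp]
    congr 3
    field_simp
  have hP := SchwartzMap.tsum_eq_tsum_fourier H 0
  simp only [zero_add, hHapp, hF] at hP
  have h0 : ∀ n : ℤ, (fourier n) ((0 : ℝ) : UnitAddCircle) = (1 : ℂ) := by
    intro n; simp
  simp only [h0, mul_one, tsum_mul_left] at hP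
  have ha0 : 𝓕 G 0 = ((∫ x, g x : ℝ) : ℂ) := by
    rw [SchwartzMap.fourier_coe, Real.fourier_real_eq, ← integral_complex_ofReal]
    simp [hGapp]
  -- Decay of order `N` of the Fourier transform of `g`, sampled at `n / X`, turns each nonzero
  -- frequency into a multiple of `(X / |n|)^N`.
  have hbound : ∀ n : ℤ, n ≠ 0 → ‖𝓕 G (n / X)‖ ≤ K * X ^ N * (1 / |(n : ℝ)| ^ N) := by
    intro n hn
    have := hK (n / X)
    have hn' : 0 < |(n : ℝ)| := abs_pos.2 (by exact_mod_cast hn)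
    rw [Real.norm_eq_abs, abs_div, abs_of_pos hX, div_pow, div_mul_eq_mul_div,
      div_le_iff₀ (by positivity)] at this
    rw [mul_one_div, le_div_iff₀ (by positivity)]
    linarith
  have hsum2 : Summable fun n : ℤ => K * X ^ N * (1 / |(n : ℝ)| ^ N) := hsum.mul_left _
  let b : ℤ → ℂ := fun n => if n = 0 then 0 else 𝓕 G (n / X)
  have hb : ∀ n, ‖b n‖ ≤ K * X ^ N * (1 / |(n : ℝ)| ^ N) := by
    intro n
    by_cases hn : n = 0
    · simp only [b, hn, if_true, norm_zero]; positivity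
    · simp only [b, hn, if_false]; exact hbound n hn
  have hbs : Summable b := Summable.of_norm_bounded hsum2 hb
  have hsplit : ∑' n : ℤ, 𝓕 G (n / X) = 𝓕 G 0 + ∑' n, b n := by
    have h1 : HasSum (fun n : ℤ => if n = 0 then 𝓕 G 0 else 0) (𝓕 G 0) := hasSum_ite_eq 0 _
    have h2 := h1.add hbs.hasSum
    rw [← h2.tsum_eq]
    refine tsum_congr fun n => ?_
    by_cases hn : n = 0
    · simp [b, hn]
    · simp [b, hn]
  have hkey : ((X * ∑' j : ℤ, g (X * j) - ∫ x, g x : ℝ) : ℂ) = ∑' n, b n := by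
    have hXc : (X : ℂ) ≠ 0 := by exact_mod_cast hX'
    rw [Complex.ofReal_sub, Complex.ofReal_mul, Complex.ofReal_tsum, hP, hsplit, ha0,
      Complex.ofReal_inv, mul_inv_cancel_left₀ hXc, add_sub_cancel_left]
  rw [← Real.norm_eq_abs, ← Complex.norm_real, hkey]
  refine (tsum_of_norm_bounded hsum2.hasSum hb).trans_eq ?_
  rw [tsum_mul_left]; ring

/-! ### Pointwise bounds for `h`. -/

/-- The first sum in the definition of `h`. -/
def hS (X : ℝ) : ℝ := ∑' j : ℕ+, 1 / (X * (j : ℝ)) * omega (X * (j : ℝ))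

/-- The second sum in the definition of `h`. -/
def hT (X y : ℝ) : ℝ := ∑' j : ℕ+, 1 / (X * (j : ℝ)) * omega (|y| / (X * (j : ℝ)))

theorem hFun_eq (X y : ℝ) : hFun X y = hS X - hT X y := rfl

/-- The logarithmic mass `∫ ω(u) / u du`. -/
def kappa : ℝ := ∫ u : ℝ, 1 / u * omega u

theorem kappa_nonneg : 0 ≤ kappa := by
  refine integral_nonneg fun u => ?_
  simp only [Pi.zero_apply]
  by_cases hu : 0 ≤ u
  · exact mul_nonneg (one_div_nonneg.2 hu) (omega_nonneg u)
  · rw [omega_of_le_half (by linarith), mul_zero]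

theorem contDiff_inv_mul_omega : ContDiff ℝ ∞ fun u : ℝ => 1 / u * omega u := by
  rw [contDiff_iff_contDiffAt]
  intro u
  by_cases hu : u = 0
  · have : (fun u : ℝ => 1 / u * omega u) =ᶠ[𝓝 u] fun _ => 0 := by
      filter_upwards [Iio_mem_nhds (show u < 1 / 2 by rw [hu]; norm_num)] with v hv
      rw [omega_of_le_half (le_of_lt hv), mul_zero]
    exact contDiffAt_const.congr_of_eventuallyEq this
  · exact (contDiffAt_const.div contDiffAt_id hu).mul contDiff_omega.contDiffAt

theorem hasCompactSupport_inv_mul_omega : HasCompactSupport fun u : ℝ => 1 / u * omega u :=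
  hasCompactSupport_omega.mul_left

theorem omega_inv_of_lt_one {s : ℝ} (hs : s < 1) : omega s⁻¹ = 0 := by
  rcases le_or_gt s 0 with h | h
  · exact omega_of_le_half (le_trans (inv_nonpos.2 h) (by norm_num))
  · exact omega_of_one_le ((one_le_inv₀ h).2 hs.le)

theorem omega_inv_of_two_le {s : ℝ} (hs : 2 ≤ s) : omega s⁻¹ = 0 := by
  refine omega_of_le_half ?_
  rw [one_div]
  exact inv_anti₀ (by norm_num) hs

theorem contDiff_inv_mul_omega_inv : ContDiff ℝ ∞ fun s : ℝ => 1 / s * omega s⁻¹ := by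
  rw [contDiff_iff_contDiffAt]
  intro u
  by_cases hu : u = 0
  · have : (fun u : ℝ => 1 / u * omega u⁻¹) =ᶠ[𝓝 u] fun _ => 0 := by
      filter_upwards [Iio_mem_nhds (show u < 1 by rw [hu]; norm_num)] with v hv
      rw [omega_inv_of_lt_one hv, mul_zero]
    exact contDiffAt_const.congr_of_eventuallyEq this
  · exact (contDiffAt_const.div contDiffAt_id hu).mul
      (contDiff_omega.contDiffAt.comp u (contDiffAt_inv ℝ hu))

theorem hasCompactSupport_inv_mul_omega_inv :
    HasCompactSupport fun s : ℝ => 1 / s * omega s⁻¹ := by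
  refine HasCompactSupport.intro (isCompact_Icc (a := (1 : ℝ)) (b := 2)) fun x hx => ?_
  by_contra h
  refine hx ⟨?_, ?_⟩
  · by_contra h'; exact h (by simp [omega_inv_of_lt_one (not_le.1 h')])
  · by_contra h'; exact h (by simp [omega_inv_of_two_le (not_le.1 h').le])

theorem integral_Ioi_eq_integral_of_nonpos {g : ℝ → ℝ} (hg : ∀ x ≤ 0, g x = 0) :
    ∫ x in Ioi (0 : ℝ), g x = ∫ x, g x := by
  refine setIntegral_eq_integral_of_forall_compl_eq_zero fun x hx => hg x ?_
  simpa using hx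

/-- The measure `du / u` is invariant under `u ↦ 1 / u`. This is why the two sums in `h` share the
main term `kappa / X`, and hence why `h` decays. -/
theorem integral_inv_mul_omega_inv : ∫ s : ℝ, 1 / s * omega s⁻¹ = kappa := by
  rw [kappa, ← integral_Ioi_eq_integral_of_nonpos (g := fun u : ℝ => 1 / u * omega u)
      (fun x hx => by rw [omega_of_le_half (by linarith), mul_zero]),
    ← integral_Ioi_eq_integral_of_nonpos (g := fun s : ℝ => 1 / s * omega s⁻¹)
      (fun x hx => by rw [omega_inv_of_lt_one (by linarith), mul_zero]),
    ← integral_comp_rpow_Ioi (fun u : ℝ => 1 / u * omega u) (p := -1) (by norm_num)]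
  refine setIntegral_congr_fun measurableSet_Ioi fun x hx => ?_
  have hx' : (0 : ℝ) < x := hx
  have h2 : x ^ (-1 - 1 : ℝ) = (x ^ 2)⁻¹ := by
    rw [show (-1 - 1 : ℝ) = -(2 : ℕ) by norm_num, Real.rpow_neg hx'.le, Real.rpow_natCast]
  simp only [Real.rpow_neg_one, h2, abs_neg, abs_one, one_mul, smul_eq_mul, one_div, inv_inv]
  field_simp

theorem tsum_int_eq_tsum_pnat {g : ℝ → ℝ} (hg : ∀ x ≤ 0, g x = 0) {X : ℝ} (hX : 0 < X) :
    ∑' j : ℤ, g (X * j) = ∑' j : ℕ+, g (X * j) := by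
  have hinj : Function.Injective fun j : ℕ+ => ((j : ℕ) : ℤ) :=
    Nat.cast_injective.comp PNat.coe_injective
  have h := hinj.tsum_eq (f := fun j : ℤ => g (X * j)) ?_
  · rw [← h]; simp
  · intro j hj
    have hj0 : 0 < j := by
      by_contra h
      refine hj (hg _ ?_)
      exact mul_nonpos_of_nonneg_of_nonpos hX.le (by exact_mod_cast not_lt.1 h)
    exact ⟨⟨j.toNat, by omega⟩, by simp [hj0.le]⟩

/-- `X * hS X` is a Riemann sum of mesh `X` for `ω(u) / u`. Dividing by `X` costs one power, so
Poisson summation is used at order `N + 1`. -/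
theorem exists_hS_bound {N : ℕ} (hN : 1 ≤ N) :
    ∃ K : ℝ, 0 ≤ K ∧ ∀ X : ℝ, 0 < X → |hS X - kappa / X| ≤ K * X ^ N := by
  obtain ⟨K, hK0, hK⟩ := exists_riemannSum_bound contDiff_inv_mul_omega
    hasCompactSupport_inv_mul_omega (N := N + 1) (by omega)
  refine ⟨K, hK0, fun X hX => ?_⟩
  have h := hK X hX
  rw [tsum_int_eq_tsum_pnat (g := fun u : ℝ => 1 / u * omega u)
    (fun x hx => by rw [omega_of_le_half (by linarith), mul_zero]) hX] at h
  change |X * hS X - kappa| ≤ _ at h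
  have h2 : hS X - kappa / X = (X * hS X - kappa) / X := by field_simp
  rw [h2, abs_div, abs_of_pos hX, div_le_iff₀ hX, mul_assoc, ← pow_succ]
  exact h

/-- In the variable `s = X j / |y|` the sum `|y| * hT X y` samples `s⁻¹ ω(s⁻¹)` with mesh `X / |y|`,
so the Poisson error is small once `|y|` is large compared with `X`. -/
theorem exists_hT_bound {N : ℕ} (hN : 2 ≤ N) :
    ∃ K : ℝ, 0 ≤ K ∧ ∀ X y : ℝ, 0 < X → y ≠ 0 →
      |hT X y - kappa / X| ≤ K * X⁻¹ * (X / |y|) ^ N := by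
  obtain ⟨K, hK0, hK⟩ := exists_riemannSum_bound contDiff_inv_mul_omega_inv
    hasCompactSupport_inv_mul_omega_inv hN
  refine ⟨K, hK0, fun X y hX hy => ?_⟩
  have hy' : 0 < |y| := abs_pos.2 hy
  have h := hK (X / |y|) (div_pos hX hy')
  rw [tsum_int_eq_tsum_pnat (g := fun s : ℝ => 1 / s * omega s⁻¹)
    (fun x hx => by rw [omega_inv_of_lt_one (by linarith), mul_zero]) (div_pos hX hy'),
    integral_inv_mul_omega_inv] at h
  have h3 : ∑' j : ℕ+, 1 / (X / |y| * (j : ℝ)) * omega (X / |y| * (j : ℝ))⁻¹ = |y| * hT X y := by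
    rw [hT, ← tsum_mul_left]
    refine tsum_congr fun j => ?_
    have hj : (j : ℝ) ≠ 0 := by exact_mod_cast j.ne_zero
    rw [show (X / |y| * (j : ℝ))⁻¹ = |y| / (X * j) by field_simp]
    field_simp
  rw [h3] at h
  have h2 : hT X y - kappa / X = X⁻¹ * (X / |y| * (|y| * hT X y) - kappa) := by field_simp
  rw [h2, abs_mul, abs_of_pos (inv_pos.2 hX), mul_comm K, mul_assoc]
  exact mul_le_mul_of_nonneg_left h (inv_pos.2 hX).le

theorem hT_of_lt {X y : ℝ} (hX : 0 < X) (hy : |y| < X / 2) : hT X y = 0 := by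
  rw [hT]
  refine (tsum_congr fun j => ?_).trans tsum_zero
  have hj : (1 : ℝ) ≤ j := by exact_mod_cast one_le
  rw [omega_of_le_half, mul_zero]
  rw [div_le_iff₀ (by positivity)]
  nlinarith

/-- For `|y| < X / 2` the second sum vanishes and `kappa / X` survives from the first. For `|y| ≥ X
/ 2` the two main terms cancel and only Poisson remainders are left. -/
theorem exists_hFun_bound {N : ℕ} (hN : 2 ≤ N) :
    ∃ K : ℝ, 0 ≤ K ∧ ∀ X y : ℝ, 0 < X →
      |hFun X y| ≤ K * X ^ N + K * X⁻¹ * ((1 + |y| / X) ^ N)⁻¹ := by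
  obtain ⟨K₁, hK₁0, hK₁⟩ := exists_hS_bound (N := N) (by omega)
  obtain ⟨K₂, hK₂0, hK₂⟩ := exists_hT_bound hN
  have hκ := kappa_nonneg
  -- The factor `3 ^ N` serves both regimes: `1 + |y| / X ≤ 3` when `|y| < X / 2`, and `X / |y| ≤ 3
  -- (1 + |y| / X)⁻¹` when `|y| ≥ X / 2`.
  refine ⟨K₁ + (kappa + K₂) * 3 ^ N, by positivity, fun X y hX => ?_⟩
  have hS := hK₁ X hX
  have hXN : 0 < X ^ N := by positivity
  have hv : 0 ≤ |y| / X := by positivity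
  have hle : K₁ * X ^ N ≤ (K₁ + (kappa + K₂) * 3 ^ N) * X ^ N := by
    gcongr; linarith [show 0 ≤ (kappa + K₂) * 3 ^ N by positivity]
  rcases lt_or_ge |y| (X / 2) with hy | hy
  · rw [hFun_eq, hT_of_lt hX hy, sub_zero]
    have h1 : |CircleMethod.hS X| ≤ K₁ * X ^ N + kappa / X := by
      have := abs_sub_abs_le_abs_sub (CircleMethod.hS X) (kappa / X)
      rw [abs_of_nonneg (show 0 ≤ kappa / X by positivity)] at this
      linarith
    refine h1.trans (add_le_add hle ?_)
    have h2 : 1 + |y| / X ≤ 3 := by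
      rw [← le_sub_iff_add_le', div_le_iff₀ hX]; linarith
    have h3 : ((3 : ℝ) ^ N)⁻¹ ≤ ((1 + |y| / X) ^ N)⁻¹ := by gcongr
    calc kappa / X = kappa * 3 ^ N * X⁻¹ * (3 ^ N)⁻¹ := by field_simp
      _ ≤ (K₁ + (kappa + K₂) * 3 ^ N) * X⁻¹ * ((1 + |y| / X) ^ N)⁻¹ := by
        gcongr
        nlinarith [show 0 ≤ K₂ * 3 ^ N by positivity]
  · have hy0 : y ≠ 0 := by
      rintro rfl
      rw [abs_zero] at hy
      linarith
    have hy' : 0 < |y| := abs_pos.2 hy0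
    have hT := hK₂ X y hX hy0
    have h1 : |hFun X y| ≤ K₁ * X ^ N + K₂ * X⁻¹ * (X / |y|) ^ N := by
      rw [hFun_eq]
      have : CircleMethod.hS X - CircleMethod.hT X y
        = (CircleMethod.hS X - kappa / X) - (CircleMethod.hT X y - kappa / X) := by ring
      rw [this]
      exact (abs_sub _ _).trans (add_le_add hS hT)
    refine h1.trans (add_le_add hle ?_)
    have h2 : X / |y| ≤ 3 * (1 + |y| / X)⁻¹ := by
      rw [← div_eq_mul_inv, div_le_div_iff₀ hy' (by positivity)]
      have : X * (1 + |y| / X) = X + |y| := by field_simp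
      linarith
    calc K₂ * X⁻¹ * (X / |y|) ^ N ≤ K₂ * X⁻¹ * (3 * (1 + |y| / X)⁻¹) ^ N := by gcongr
      _ = K₂ * 3 ^ N * X⁻¹ * ((1 + |y| / X) ^ N)⁻¹ := by rw [mul_pow, inv_pow]; ring
      _ ≤ (K₁ + (kappa + K₂) * 3 ^ N) * X⁻¹ * ((1 + |y| / X) ^ N)⁻¹ := by
        gcongr
        nlinarith [show 0 ≤ kappa * 3 ^ N by positivity]

/-- On bounded sets the sum `hT X` is a finite sum, uniformly in the second variable. -/
theorem exists_finset_hT {X : ℝ} (hX : 0 < X) (R : ℝ) :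
    ∃ F : Finset ℕ+, (∀ j ∉ F, 2 * R < X * (j : ℝ)) ∧ ∀ y : ℝ, |y| ≤ R →
      hT X y = ∑ j ∈ F, 1 / (X * (j : ℝ)) * omega (|y| / (X * (j : ℝ))) := by
  let F : Finset ℕ+ := Finset.Icc 1 ⌊2 * R / X⌋₊.succPNat
  have hF : ∀ j ∉ F, 2 * R < X * (j : ℝ) := by
    intro j hj
    have h1 : ⌊2 * R / X⌋₊ + 1 < (j : ℕ) := by
      by_contra h
      refine hj (Finset.mem_Icc.2 ⟨one_le, ?_⟩)
      exact (PNat.coe_le_coe _ _).1 (not_lt.1 h)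
    have h2 : 2 * R / X < j := by
      refine (Nat.lt_floor_add_one _).trans_le ?_
      exact_mod_cast h1.le
    rw [div_lt_iff₀ hX] at h2
    linarith
  refine ⟨F, hF, fun y hy => ?_⟩
  rw [hT]
  refine tsum_eq_sum fun j hj => ?_
  have hj0 : (0 : ℝ) < j := by exact_mod_cast j.pos
  rw [omega_of_le_half, mul_zero]
  rw [div_le_iff₀ (by positivity)]
  linarith [hF j hj]

theorem continuous_hFun {X : ℝ} (hX : 0 < X) : Continuous (hFun X) := by
  have : Continuous (hT X) := by
    rw [continuous_iff_continuousAt]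
    intro y
    obtain ⟨F, -, hF⟩ := exists_finset_hT hX (|y| + 1)
    have h1 : hT X =ᶠ[𝓝 y]
        fun y => ∑ j ∈ F, 1 / (X * (j : ℝ)) * omega (|y| / (X * (j : ℝ))) := by
      have : ∀ᶠ v in 𝓝 y, |v| < |y| + 1 :=
        continuous_abs.continuousAt.eventually (Iio_mem_nhds (by linarith))
      filter_upwards [this] with v hv using hF v hv.le
    refine ContinuousAt.congr ?_ h1.symm
    have h2 := contDiff_omega.continuous
    have : Continuous fun y : ℝ => ∑ j ∈ F, 1 / (X * (j : ℝ)) * omega (|y| / (X * (j : ℝ))) := by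
      refine continuous_finsetSum _ fun j _ => continuous_const.mul (h2.comp ?_)
      exact continuous_abs.div_const _
    exact this.continuousAt
  exact continuous_const.sub this

theorem hFun_neg (X y : ℝ) : hFun X (-y) = hFun X y := by
  simp only [hFun, abs_neg]

/-! ### Moments of `h` over `[-1, 1]`. -/

/-- The partial moments `∫_0^v ω(u) u^k du`. -/
def omegaMoment (k : ℕ) (v : ℝ) : ℝ := ∫ u in (0 : ℝ)..v, omega u * u ^ k

theorem continuous_omega_mul_pow (k : ℕ) : Continuous fun u : ℝ => omega u * u ^ k :=
  contDiff_omega.continuous.mul (by fun_prop)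

theorem hasDerivAt_omegaMoment (k : ℕ) (v : ℝ) :
    HasDerivAt (omegaMoment k) (omega v * v ^ k) v :=
  (continuous_omega_mul_pow k).integral_hasStrictDerivAt 0 v |>.hasDerivAt

theorem contDiff_omegaMoment (k : ℕ) : ContDiff ℝ ∞ (omegaMoment k) := by
  rw [contDiff_infty_iff_deriv]
  refine ⟨fun v => (hasDerivAt_omegaMoment k v).differentiableAt, ?_⟩
  rw [funext fun v => (hasDerivAt_omegaMoment k v).deriv]
  exact contDiff_omega.mul (by fun_prop)

theorem omegaMoment_of_le_half {k : ℕ} {v : ℝ} (h0 : 0 ≤ v) (hv : v ≤ 1 / 2) :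
    omegaMoment k v = 0 := by
  rw [omegaMoment, intervalIntegral.integral_congr (g := fun _ => 0)]
  · simp
  · intro u hu
    rw [uIcc_of_le h0] at hu
    simp only
    rw [omega_of_le_half (hu.2.trans hv), zero_mul]

theorem omegaMoment_of_one_le {k : ℕ} {v : ℝ} (hv : 1 ≤ v) :
    omegaMoment k v = omegaMoment k 1 := by
  have h := intervalIntegral.integral_add_adjacent_intervals
    ((continuous_omega_mul_pow k).intervalIntegrable (μ := volume) 0 1)
    ((continuous_omega_mul_pow k).intervalIntegrable (μ := volume) 1 v)
  rw [omegaMoment, ← h, omegaMoment, intervalIntegral.integral_congr (a := 1) (b := v)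
    (g := fun _ => 0)]
  · simp
  · intro u hu
    rw [uIcc_of_le hv] at hu
    simp only
    rw [omega_of_one_le hu.1, zero_mul]

theorem omegaMoment_zero_one : omegaMoment 0 1 = 1 := by
  rw [omegaMoment, intervalIntegral.integral_of_le zero_le_one]
  refine Eq.trans ?_ integral_omega
  simp only [pow_zero, mul_one]
  refine setIntegral_eq_integral_of_forall_compl_eq_zero fun x hx => ?_
  by_cases h : 0 < x
  · exact omega_of_one_le (not_lt.1 fun h' => hx ⟨h, h'.le⟩)
  · exact omega_of_le_half (by linarith)

/-- The even profile `r ↦ r^k ∫_0^{1/|r|} ω(u) u^k du` (continued smoothly to `r = 0`). -/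
def momentProfile (k : ℕ) (r : ℝ) : ℝ := r ^ k * omegaMoment k (max |r| (1 / 2))⁻¹

theorem momentProfile_of_abs_lt {k : ℕ} {r : ℝ} (hr : |r| < 1) :
    momentProfile k r = r ^ k * omegaMoment k 1 := by
  rw [momentProfile, omegaMoment_of_one_le]
  exact (one_le_inv₀ (by positivity)).2 (max_le hr.le (by norm_num))

theorem momentProfile_of_half_lt {k : ℕ} {r : ℝ} (hr : 1 / 2 < |r|) :
    momentProfile k r = r ^ k * omegaMoment k |r|⁻¹ := by
  rw [momentProfile, max_eq_left hr.le]

theorem momentProfile_of_two_le {k : ℕ} {r : ℝ} (hr : 2 ≤ |r|) : momentProfile k r = 0 := by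
  rw [momentProfile_of_half_lt (by linarith), omegaMoment_of_le_half (by positivity), mul_zero]
  rw [one_div]
  exact inv_anti₀ (by norm_num) hr

theorem momentProfile_of_pos {k : ℕ} {r : ℝ} (hr : 0 < r) :
    momentProfile k r = r ^ k * omegaMoment k r⁻¹ := by
  rcases lt_or_ge r 1 with h | h
  · rw [momentProfile_of_abs_lt (by rwa [abs_of_pos hr]),
      omegaMoment_of_one_le ((one_le_inv₀ hr).2 h.le)]
  · rw [momentProfile_of_half_lt (by rw [abs_of_pos hr]; linarith), abs_of_pos hr]

theorem hasCompactSupport_momentProfile (k : ℕ) : HasCompactSupport (momentProfile k) := by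
  refine HasCompactSupport.intro (isCompact_Icc (a := (-2 : ℝ)) (b := 2)) fun x hx => ?_
  refine momentProfile_of_two_le ?_
  by_contra h
  exact hx (abs_le.1 (not_le.1 h).le)

/-- For `|r| < 1` the upper limit `1 / |r|` lies beyond the support of `ω`, so the profile is a
multiple of `r ^ k` there; away from `0` it is a composition with the smooth function `|r|⁻¹`. -/
theorem contDiff_momentProfile (k : ℕ) : ContDiff ℝ ∞ (momentProfile k) := by
  rw [contDiff_iff_contDiffAt]
  intro r
  rcases lt_or_ge |r| 1 with hr | hr
  · have : momentProfile k =ᶠ[𝓝 r] fun r => r ^ k * omegaMoment k 1 := by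
      filter_upwards [continuous_abs.continuousAt.eventually (Iio_mem_nhds hr)] with v hv
      exact momentProfile_of_abs_lt hv
    refine ContDiffAt.congr_of_eventuallyEq ?_ this
    fun_prop
  · have : momentProfile k =ᶠ[𝓝 r] fun r => r ^ k * omegaMoment k |r|⁻¹ := by
      filter_upwards [continuous_abs.continuousAt.eventually
        (Ioi_mem_nhds (show 1 / 2 < |r| by linarith))] with v hv
      exact momentProfile_of_half_lt hv
    refine ContDiffAt.congr_of_eventuallyEq ?_ this
    have hr0 : r ≠ 0 := by
      rintro rfl
      rw [abs_zero] at hr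
      linarith
    have h1 : ContDiffAt ℝ ∞ (fun r : ℝ => |r|⁻¹) r :=
      (contDiffAt_abs hr0).inv (abs_ne_zero.2 hr0)
    exact ContDiffAt.mul (by fun_prop) ((contDiff_omegaMoment k).contDiffAt.comp r h1)

theorem momentProfile_neg {k : ℕ} (hk : Even k) (r : ℝ) :
    momentProfile k (-r) = momentProfile k r := by
  simp only [momentProfile, hk.neg_pow, abs_neg]

/-- Integrating this identity over `ℝ`, where the left side contributes nothing by compact support,
evaluates the integral of the profile in terms of `kappa`. Evenness of `k` is used to replace `r ^
k` by `|r| ^ k`. -/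
theorem hasDerivAt_mul_momentProfile {k : ℕ} (hk : Even k) (r : ℝ) :
    HasDerivAt (fun r => r * momentProfile k r)
      ((k + 1) * momentProfile k r - 1 / |r| * omega |r|⁻¹) r := by
  rcases lt_or_ge |r| 1 with hr | hr
  · have : (fun r => r * momentProfile k r) =ᶠ[𝓝 r] fun r => r ^ (k + 1) * omegaMoment k 1 := by
      filter_upwards [continuous_abs.continuousAt.eventually (Iio_mem_nhds hr)] with v hv
      rw [momentProfile_of_abs_lt hv]; ring
    refine HasDerivAt.congr_of_eventuallyEq ?_ this
    rw [omega_inv_of_lt_one hr, momentProfile_of_abs_lt hr]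
    convert! (hasDerivAt_pow (k + 1) r).mul_const (omegaMoment k 1) using 1
    push_cast
    simp
    ring
  · have hr0 : r ≠ 0 := by
      rintro rfl
      rw [abs_zero] at hr
      linarith
    have : (fun r => r * momentProfile k r) =ᶠ[𝓝 r]
        fun r => r ^ (k + 1) * omegaMoment k |r|⁻¹ := by
      filter_upwards [continuous_abs.continuousAt.eventually
        (Ioi_mem_nhds (show 1 / 2 < |r| by linarith))] with v hv
      rw [momentProfile_of_half_lt hv]; ring
    refine HasDerivAt.congr_of_eventuallyEq ?_ this
    rw [momentProfile_of_half_lt (by linarith)]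
    have habs : HasDerivAt (fun r : ℝ => |r|) (r / |r|) r := by
      rcases lt_or_gt_of_ne hr0 with h | h
      · convert! hasDerivAt_abs_neg h using 1
        rw [abs_of_neg h]; field_simp
      · convert! hasDerivAt_abs_pos h using 1
        rw [abs_of_pos h]; field_simp
    have h1 : HasDerivAt (fun r : ℝ => |r|⁻¹) (-(r / |r|) / |r| ^ 2) r :=
      habs.inv (abs_ne_zero.2 hr0)
    have h2 : HasDerivAt (fun r : ℝ => omegaMoment k |r|⁻¹)
        (omega |r|⁻¹ * |r|⁻¹ ^ k * (-(r / |r|) / |r| ^ 2)) r := by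
      have := (hasDerivAt_omegaMoment k |r|⁻¹).comp r h1
      exact this
    convert! (hasDerivAt_pow (k + 1) r).mul h2 using 1
    have h3 : r ^ k = |r| ^ k := (hk.pow_abs r).symm
    have ha : |r| ≠ 0 := abs_ne_zero.2 hr0
    have h4 : r ^ (k + 1) * r = |r| ^ k * |r| ^ 2 := by rw [pow_succ, h3, sq_abs]; ring
    have h5 : r ^ (k + 1) * (omega |r|⁻¹ * |r|⁻¹ ^ k * (-(r / |r|) / |r| ^ 2))
        = -(r ^ (k + 1) * r) * (omega |r|⁻¹ * |r|⁻¹ ^ k / |r| / |r| ^ 2) := by ring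
    rw [h5, h4]
    push_cast
    rw [inv_pow]
    field_simp
    ring

theorem integral_momentProfile {k : ℕ} (hk : Even k) :
    ∫ r, momentProfile k r = 2 / (k + 1) * kappa := by
  have hi1 : Integrable (momentProfile k) :=
    (contDiff_momentProfile k).continuous.integrable_of_hasCompactSupport
      (hasCompactSupport_momentProfile k)
  have hi2 : Integrable fun r : ℝ => 1 / |r| * omega |r|⁻¹ := by
    have := (contDiff_inv_mul_omega_inv.continuous.comp continuous_abs)
    refine this.integrable_of_hasCompactSupport ?_
    refine HasCompactSupport.intro (isCompact_Icc (a := (-2 : ℝ)) (b := 2)) fun x hx => ?_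
    simp only [Function.comp]
    rw [omega_inv_of_two_le, mul_zero]
    by_contra h
    exact hx (abs_le.1 (not_le.1 h).le)
  have hi3 : Integrable fun r => r * momentProfile k r :=
    (continuous_id.mul (contDiff_momentProfile k).continuous).integrable_of_hasCompactSupport
      (hasCompactSupport_momentProfile k).mul_left
  have h := integral_eq_zero_of_hasDerivAt_of_integrable
    (fun r => hasDerivAt_mul_momentProfile hk r) ((hi1.const_mul _).sub hi2) hi3
  rw [integral_sub (hi1.const_mul _) hi2, integral_const_mul,
    integral_comp_abs (f := fun r => 1 / r * omega r⁻¹),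
    integral_Ioi_eq_integral_of_nonpos (g := fun s : ℝ => 1 / s * omega s⁻¹)
      (fun x hx => by rw [omega_inv_of_lt_one (by linarith), mul_zero]),
    integral_inv_mul_omega_inv] at h
  have : (k + 1 : ℝ) ≠ 0 := by positivity
  field_simp
  linarith

theorem momentProfile_zero {k : ℕ} : momentProfile k 0 = if k = 0 then 1 else 0 := by
  rw [momentProfile_of_abs_lt (by simp)]
  split_ifs with hk
  · subst hk; rw [omegaMoment_zero_one]; simp
  · rw [zero_pow hk, zero_mul]

/-- The substitution `s = r u` on each half-line. With `r = X j` it turns the moments of `hT` into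
sums of the profile over the points `X j`, again accessible to Poisson summation. -/
theorem integral_pow_mul_omega_abs_div {k : ℕ} (hk : Even k) {r : ℝ} (hr : 0 < r) :
    ∫ s in (-1 : ℝ)..1, s ^ k * (1 / r * omega (|s| / r)) = 2 * momentProfile k r := by
  have hc : Continuous fun s : ℝ => s ^ k * (1 / r * omega (|s| / r)) :=
    (continuous_pow k).mul (continuous_const.mul
      (contDiff_omega.continuous.comp (continuous_abs.div_const _)))
  have h1 := intervalIntegral.integral_add_adjacent_intervals
    (hc.intervalIntegrable (μ := volume) (-1) 0) (hc.intervalIntegrable (μ := volume) 0 1)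
  have h2 : ∫ s in (-1 : ℝ)..0, s ^ k * (1 / r * omega (|s| / r))
      = ∫ s in (0 : ℝ)..1, s ^ k * (1 / r * omega (|s| / r)) := by
    have := intervalIntegral.integral_comp_neg (a := 0) (b := 1)
      (fun s : ℝ => s ^ k * (1 / r * omega (|s| / r)))
    simp only [abs_neg, hk.neg_pow, neg_zero] at this
    exact this.symm
  have h3 : ∫ s in (0 : ℝ)..1, s ^ k * (1 / r * omega (|s| / r)) = momentProfile k r := by
    rw [momentProfile_of_pos hr]
    have h4 := intervalIntegral.integral_comp_div (a := 0) (b := 1)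
      (fun u : ℝ => r ^ k / r * (omega u * u ^ k)) hr.ne'
    rw [zero_div, one_div] at h4
    rw [omegaMoment, show r ^ k * (∫ u in (0 : ℝ)..r⁻¹, omega u * u ^ k)
      = r • (r ^ k / r * ∫ u in (0 : ℝ)..r⁻¹, omega u * u ^ k) by
        rw [smul_eq_mul]; field_simp, ← intervalIntegral.integral_const_mul, ← h4]
    refine intervalIntegral.integral_congr fun s hs => ?_
    rw [uIcc_of_le zero_le_one] at hs
    simp only [abs_of_nonneg hs.1, div_pow]
    field_simp
  rw [← h1, h2, h3]; ring

/-- Odd moments vanish by parity. For even `k` the moment is `2 / (k + 1) * hS X` minus twice the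
sum of the profile over `X j`, `j ≥ 1`. Completing the latter to a sum over `ℤ` costs the term `j =
0`, whose value is `1` for `k = 0` and `0` otherwise: this is the Dirac mass. The main terms `2
kappa / ((k + 1) X)` cancel. -/
theorem exists_moment_bound (k : ℕ) {N : ℕ} (hN : 1 ≤ N) :
    ∃ K : ℝ, 0 ≤ K ∧ ∀ X : ℝ, 0 < X →
      |(∫ s in (-1 : ℝ)..1, s ^ k * hFun X s) - if k = 0 then 1 else 0| ≤ K * X ^ N := by
  by_cases hk : Even k
  swap
  · refine ⟨0, le_rfl, fun X hX => ?_⟩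
    have hk0 : k ≠ 0 := by rintro rfl; exact hk (by simp)
    have := intervalIntegral.integral_comp_neg (a := -1) (b := 1) (fun s => s ^ k * hFun X s)
    simp only [hFun_neg, (Nat.not_even_iff_odd.1 hk).neg_pow, neg_neg, neg_mul,
      intervalIntegral.integral_neg] at this
    have h0 : ∫ s in (-1 : ℝ)..1, s ^ k * hFun X s = 0 := by linarith
    simp [h0, hk0]
  obtain ⟨K₁, hK₁0, hK₁⟩ := exists_hS_bound hN
  obtain ⟨K₂, hK₂0, hK₂⟩ := exists_riemannSum_bound (contDiff_momentProfile k)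
    (hasCompactSupport_momentProfile k) (N := N + 1) (by omega)
  refine ⟨2 / (k + 1) * K₁ + K₂, by positivity, fun X hX => ?_⟩
  obtain ⟨F, hF, hFT⟩ := exists_finset_hT hX 1
  have hint : ∫ s in (-1 : ℝ)..1, s ^ k * hFun X s
      = 2 / (k + 1) * hS X - 2 * ∑' j : ℕ+, momentProfile k (X * j) := by
    have h1 : ∫ s in (-1 : ℝ)..1, s ^ k * hFun X s = ∫ s in (-1 : ℝ)..1, (s ^ k * hS X -
        ∑ j ∈ F, s ^ k * (1 / (X * (j : ℝ)) * omega (|s| / (X * (j : ℝ))))) := by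
      refine intervalIntegral.integral_congr fun s hs => ?_
      rw [uIcc_of_le (by norm_num)] at hs
      simp only [hFun_eq, hFT s (abs_le.2 hs), mul_sub, Finset.mul_sum]
    have hc : ∀ j ∈ F, IntervalIntegrable
        (fun s : ℝ => s ^ k * (1 / (X * (j : ℝ)) * omega (|s| / (X * (j : ℝ))))) volume (-1) 1 :=
      fun j _ => ((continuous_pow k).mul (continuous_const.mul
        (contDiff_omega.continuous.comp (continuous_abs.div_const _)))).intervalIntegrable _ _
    rw [h1, intervalIntegral.integral_sub, intervalIntegral.integral_mul_const, integral_pow,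
      intervalIntegral.integral_finsetSum hc]
    · congr 1
      · simp only [one_pow, (hk.add_one).neg_pow]
        ring
      · rw [tsum_eq_sum (s := F), Finset.mul_sum]
        · refine Finset.sum_congr rfl fun j _ => ?_
          exact integral_pow_mul_omega_abs_div hk (by positivity)
        · intro j hj
          refine momentProfile_of_two_le ?_
          have := hF j hj
          exact le_trans (by linarith) (le_abs_self _)
    · exact Continuous.intervalIntegrable (by fun_prop) _ _
    · simpa only [Finset.sum_fn] using IntervalIntegrable.sum _ hc
  have hsum : Summable fun j : ℤ => momentProfile k (X * j) := by
    refine summable_of_hasFiniteSupport ?_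
    refine (Set.finite_Icc (-⌈2 / X⌉) ⌈2 / X⌉).subset fun j hj => ?_
    have h1 : |X * (j : ℝ)| < 2 := by
      by_contra h
      exact hj (momentProfile_of_two_le (not_lt.1 h))
    rw [abs_mul, abs_of_pos hX, mul_comm, ← lt_div_iff₀ hX] at h1
    have h2 := (h1.trans_le (Int.le_ceil _)).le
    rw [← Int.cast_abs, Int.cast_le] at h2
    exact abs_le.1 h2
  have heven : ∑' j : ℤ, momentProfile k (X * j)
      = (if k = 0 then 1 else 0) + 2 * ∑' j : ℕ+, momentProfile k (X * j) := by
    have := tsum_int_eq_zero_add_two_mul_tsum_pnat (f := fun j : ℤ => momentProfile k (X * j))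
      (fun j => by simp [mul_neg, momentProfile_neg hk]) hsum
    simpa [momentProfile_zero, two_mul, two_smul] using this
  have hb := hK₂ X hX
  rw [integral_momentProfile hk, heven] at hb
  have hs := hK₁ X hX
  have key : (∫ s in (-1 : ℝ)..1, s ^ k * hFun X s) - (if k = 0 then 1 else 0)
      = 2 / (k + 1) * (hS X - kappa / X) - (X * ((if k = 0 then 1 else 0) +
        2 * ∑' j : ℕ+, momentProfile k (X * j)) - 2 / (k + 1) * kappa) / X := by
    rw [hint]; field_simp; ring
  rw [key]
  refine (abs_sub _ _).trans ?_
  rw [abs_mul, abs_of_nonneg (show (0 : ℝ) ≤ 2 / (k + 1) by positivity), abs_div, abs_of_pos hX]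
  have h1 : |X * ((if k = 0 then 1 else 0) + 2 * ∑' j : ℕ+, momentProfile k (X * j))
      - 2 / (k + 1) * kappa| / X ≤ K₂ * X ^ N := by
    rw [div_le_iff₀ hX, mul_assoc, ← pow_succ]; exact hb
  have h2 : 2 / (k + 1) * |hS X - kappa / X| ≤ 2 / (k + 1) * (K₁ * X ^ N) := by gcongr
  linarith

/-! ### Approximation of the Dirac mass on smooth test functions. -/

theorem one_le_factorial_cast (k : ℕ) : (1 : ℝ) ≤ k.factorial := by
  exact_mod_cast Nat.succ_le_of_lt k.factorial_pos

theorem abs_sub_taylor_le {m : ℕ} {φ : ℝ → ℝ} (hφ : ContDiff ℝ m φ) {D : ℝ}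
    (hD : ∀ s, |iteratedDeriv m φ s| ≤ D) (s : ℝ) :
    |φ s - ∑ k ∈ Finset.range m, iteratedDeriv k φ 0 / k.factorial * s ^ k| ≤ D * |s| ^ m := by
  have hD0 : 0 ≤ D := (abs_nonneg _).trans (hD 0)
  rcases m with _ | m
  · simpa using hD s
  rcases eq_or_ne s 0 with rfl | hs
  · rw [Finset.sum_range_succ']
    simp
  · have hu : UniqueDiffOn ℝ (uIcc 0 s) := uniqueDiffOn_uIcc hs.symm
    obtain ⟨x', -, hx'⟩ := taylor_mean_remainder_lagrange_iteratedDeriv (n := m) hs.symm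
      (f := φ) (by exact_mod_cast hφ.contDiffOn)
    have h1 : taylorWithinEval φ m (uIcc 0 s) 0 s
        = ∑ k ∈ Finset.range (m + 1), iteratedDeriv k φ 0 / k.factorial * s ^ k := by
      rw [taylor_within_apply]
      refine Finset.sum_congr rfl fun k hk => ?_
      have hk' : k ≤ m + 1 := (Finset.mem_range.1 hk).le
      rw [iteratedDerivWithin_eq_iteratedDeriv hu
        (hφ.contDiffAt.of_le (by exact_mod_cast hk')) left_mem_uIcc]
      simp only [sub_zero, smul_eq_mul]
      ring
    rw [← h1, hx', sub_zero, abs_div, abs_mul, abs_pow, Nat.abs_cast]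
    refine (div_le_self (by positivity) (one_le_factorial_cast _)).trans ?_
    gcongr
    exact hD x'

theorem pow_le_rpow_interp {t p : ℝ} {M : ℕ} (ht : 0 < t) (hp1 : (M : ℝ) ≤ p) (hp2 : p ≤ M + 1) :
    min (t ^ M) (t ^ (M + 1)) ≤ t ^ p := by
  rcases le_or_gt t 1 with h | h
  · refine (min_le_right _ _).trans ?_
    rw [← Real.rpow_natCast]
    exact Real.rpow_le_rpow_of_exponent_ge ht h (by exact_mod_cast hp2)
  · refine (min_le_left _ _).trans ?_
    rw [← Real.rpow_natCast]
    exact Real.rpow_le_rpow_of_exponent_le h.le hp1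

/-- The remainder has order `M + 1`; moving the top Taylor term into the error also bounds it at
order `M`. Interpolating between the two gives any real order `p` in between. This freedom is what
later keeps the singular weight `|x i|^(-p)` integrable. -/
theorem abs_sub_taylor_le_rpow {M : ℕ} {φ : ℝ → ℝ} (hφ : ContDiff ℝ (M + 1 : ℕ) φ) {A B p : ℝ}
    (hA : 0 < A) (hp1 : (M : ℝ) ≤ p) (hp2 : p ≤ M + 1)
    (hD : ∀ k ≤ M + 1, ∀ s, |iteratedDeriv k φ s| ≤ A ^ k * B) (s : ℝ) :
    |φ s - ∑ k ∈ Finset.range (M + 1), iteratedDeriv k φ 0 / k.factorial * s ^ k| ≤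
      2 * B * (A ^ p * |s| ^ p) := by
  have hB0 : 0 ≤ B := (abs_nonneg _).trans (by simpa using hD 0 (by omega) 0)
  rcases eq_or_ne s 0 with rfl | hs
  · rw [Finset.sum_range_succ']
    simp
    positivity
  have hs' : 0 < |s| := abs_pos.2 hs
  have h1 := abs_sub_taylor_le hφ (hD (M + 1) le_rfl) s
  have h2 := abs_sub_taylor_le (hφ.of_le (by exact_mod_cast M.le_succ)) (hD M (by omega)) s
  have h3 : |iteratedDeriv M φ 0 / M.factorial * s ^ M| ≤ A ^ M * B * |s| ^ M := by
    rw [abs_mul, abs_div, abs_pow, Nat.abs_cast]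
    gcongr
    exact (div_le_self (abs_nonneg _) (one_le_factorial_cast _)).trans (hD M (by omega) 0)
  have h4 : |φ s - ∑ k ∈ Finset.range (M + 1), iteratedDeriv k φ 0 / k.factorial * s ^ k| ≤
      2 * B * (A * |s|) ^ M := by
    rw [Finset.sum_range_succ, ← sub_sub]
    refine (abs_sub _ _).trans ((add_le_add h2 h3).trans_eq ?_)
    rw [mul_pow]; ring
  have h5 : |φ s - ∑ k ∈ Finset.range (M + 1), iteratedDeriv k φ 0 / k.factorial * s ^ k| ≤
      2 * B * (A * |s|) ^ (M + 1) := by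
    refine h1.trans ?_
    rw [mul_pow]
    nlinarith [show 0 ≤ A ^ (M + 1) * |s| ^ (M + 1) * B by positivity]
  rw [← Real.mul_rpow hA.le hs'.le]
  refine (le_min h4 h5).trans ?_
  rw [← mul_min_of_nonneg _ _ (by positivity)]
  exact mul_le_mul_of_nonneg_left (pow_le_rpow_interp (by positivity) hp1 hp2) (by positivity)

theorem exists_hFun_le (C : ℝ) (hC : 0 < C) :
    ∃ K : ℝ, 0 ≤ K ∧ ∀ X y : ℝ, 0 < X → X ≤ C → |hFun X y| ≤ K / X := by
  obtain ⟨K, hK0, hK⟩ := exists_hFun_bound (N := 2) le_rfl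
  refine ⟨K * C ^ 3 + K, by positivity, fun X y hX hXC => (hK X y hX).trans ?_⟩
  have h1 : ((1 + |y| / X) ^ 2)⁻¹ ≤ 1 :=
    inv_le_one_of_one_le₀ (one_le_pow₀ (by linarith [show 0 ≤ |y| / X by positivity]))
  have h2 : K * X ^ 2 ≤ K * C ^ 3 / X := by
    rw [le_div_iff₀ hX]
    have : X ^ 3 ≤ C ^ 3 := by gcongr
    nlinarith
  have h3 : K * X⁻¹ * ((1 + |y| / X) ^ 2)⁻¹ ≤ K * X⁻¹ := mul_le_of_le_one_right (by positivity) h1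
  rw [add_div, div_eq_mul_inv K X]
  exact add_le_add h2 h3

theorem exists_hFun_tail_bound (M : ℕ) {C : ℝ} (hC : 0 < C) :
    ∃ K : ℝ, 0 ≤ K ∧ ∀ X y : ℝ, 0 < X → X ≤ C → 1 ≤ |y| → |hFun X y| ≤ K * X ^ M := by
  obtain ⟨K, hK0, hK⟩ := exists_hFun_bound (N := M + 2) (by omega)
  refine ⟨K * (C ^ 2 + C), by positivity, fun X y hX hXC hy => (hK X y hX).trans ?_⟩
  have h1 : ((1 + |y| / X) ^ (M + 2))⁻¹ ≤ X ^ (M + 2) := by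
    rw [← inv_pow]
    refine pow_le_pow_left₀ (by positivity) ?_ _
    rw [inv_le_comm₀ (by positivity) hX, ← one_div]
    have : 1 / X ≤ |y| / X := by gcongr
    linarith
  have h2 : K * X⁻¹ * ((1 + |y| / X) ^ (M + 2))⁻¹ ≤ K * X ^ M * X := by
    refine (mul_le_mul_of_nonneg_left h1 (by positivity)).trans_eq ?_
    field_simp
    ring
  have h3 : K * X ^ M * (X ^ 2 + X) ≤ K * X ^ M * (C ^ 2 + C) := by gcongr
  calc _ ≤ K * X ^ (M + 2) + K * X ^ M * X := by gcongr
    _ = K * X ^ M * (X ^ 2 + X) := by ring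
    _ ≤ _ := by linarith

theorem integrable_one_add_abs_sq : Integrable fun v : ℝ => ((1 + |v|) ^ 2)⁻¹ := by
  have := integrable_one_add_norm (E := ℝ) (μ := volume) (r := 2) (by simp)
  refine this.congr (Eventually.of_forall fun v => ?_)
  simp only [Real.norm_eq_abs]
  rw [Real.rpow_neg (by positivity)]
  norm_cast

/-- Scaling by `s = X v`: the factor `|s|^p` yields `X^p` times at most `(1 + |v|)^M`, and decay of
order `M + 2` in the kernel leaves the integrable `(1 + |v|)⁻²`. -/
theorem exists_weighted_integral_bound (M : ℕ) {C p : ℝ} (hC : 0 < C) (hp0 : 0 ≤ p)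
    (hp : p ≤ M) :
    ∃ K : ℝ, 0 ≤ K ∧ ∀ X : ℝ, 0 < X → X ≤ C →
      ∫ s in Ioc (-1 : ℝ) 1, |s| ^ p * |hFun X s| ≤ K * X ^ p := by
  obtain ⟨K, hK0, hK⟩ := exists_hFun_bound (N := M + 2) (by omega)
  set J : ℝ := ∫ v : ℝ, ((1 + |v|) ^ 2)⁻¹ with hJ
  have hJ0 : 0 ≤ J := integral_nonneg fun v => by positivity
  refine ⟨2 * K * (1 + C) ^ (M + 2) + K * J, by positivity, fun X hX hXC => ?_⟩
  have hint : Integrable fun s : ℝ => K * X ^ p * (X⁻¹ * ((1 + |s / X|) ^ 2)⁻¹) :=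
    ((integrable_one_add_abs_sq.comp_div hX.ne').const_mul _).const_mul _
  have hpt : ∀ s ∈ Ioc (-1 : ℝ) 1, |s| ^ p * |hFun X s| ≤
      K * X ^ (M + 2) + K * X ^ p * (X⁻¹ * ((1 + |s / X|) ^ 2)⁻¹) := by
    intro s hs
    have hs1 : |s| ≤ 1 := abs_le.2 ⟨hs.1.le, hs.2⟩
    have h1 : |s| ^ p ≤ 1 := Real.rpow_le_one (abs_nonneg _) hs1 hp0
    have hv : 0 ≤ |s| / X := by positivity
    have h2 : |s| ^ p ≤ X ^ p * (1 + |s| / X) ^ M := by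
      calc |s| ^ p = X ^ p * (|s| / X) ^ p := by
            rw [← Real.mul_rpow hX.le hv]; congr 1; field_simp
        _ ≤ X ^ p * (1 + |s| / X) ^ p := by
            gcongr; linarith
        _ ≤ X ^ p * (1 + |s| / X) ^ (M : ℝ) := by
            gcongr; linarith
        _ = _ := by rw [Real.rpow_natCast]
    calc |s| ^ p * |hFun X s|
        ≤ |s| ^ p * (K * X ^ (M + 2) + K * X⁻¹ * ((1 + |s| / X) ^ (M + 2))⁻¹) := by
          gcongr; exact hK X s hX
      _ = |s| ^ p * (K * X ^ (M + 2)) + |s| ^ p * (K * X⁻¹ * ((1 + |s| / X) ^ (M + 2))⁻¹) := by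
          ring
      _ ≤ 1 * (K * X ^ (M + 2)) +
          X ^ p * (1 + |s| / X) ^ M * (K * X⁻¹ * ((1 + |s| / X) ^ (M + 2))⁻¹) := by gcongr
      _ = _ := by
          rw [abs_div, abs_of_pos hX, pow_add (1 + |s| / X)]
          have hv1 : 1 + |s| / X > 0 := by positivity
          generalize 1 + |s| / X = v at hv1
          have : v ≠ 0 := hv1.ne'
          field_simp
  have hXp : X ^ (M + 2) ≤ (1 + C) ^ (M + 2) * X ^ p := by
    have h1 : X ^ (M + 2) = X ^ ((M + 2 : ℕ) - p : ℝ) * X ^ p := by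
      rw [← Real.rpow_add hX, sub_add_cancel, Real.rpow_natCast]
    rw [h1]
    gcongr
    calc X ^ ((M + 2 : ℕ) - p : ℝ) ≤ (1 + C) ^ ((M + 2 : ℕ) - p : ℝ) := by
          refine Real.rpow_le_rpow hX.le (by linarith) ?_
          push_cast; linarith
      _ ≤ (1 + C) ^ ((M + 2 : ℕ) : ℝ) :=
          Real.rpow_le_rpow_of_exponent_le (by linarith) (by linarith)
      _ = _ := Real.rpow_natCast _ _
  have hmeas : Measurable fun s : ℝ => |s| ^ p * |hFun X s| := by
    have := (continuous_hFun hX).measurable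
    fun_prop
  have hbound : Integrable (fun s : ℝ => K * X ^ (M + 2) +
      K * X ^ p * (X⁻¹ * ((1 + |s / X|) ^ 2)⁻¹)) (volume.restrict (Ioc (-1 : ℝ) 1)) :=
    (integrable_const _).add hint.restrict
  calc ∫ s in Ioc (-1 : ℝ) 1, |s| ^ p * |hFun X s|
      ≤ ∫ s in Ioc (-1 : ℝ) 1, (K * X ^ (M + 2) +
          K * X ^ p * (X⁻¹ * ((1 + |s / X|) ^ 2)⁻¹)) := by
        refine integral_mono_of_nonneg (Eventually.of_forall fun s => by positivity) hbound ?_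
        exact (ae_restrict_iff' measurableSet_Ioc).2 (Eventually.of_forall hpt)
    _ = 2 * K * X ^ (M + 2) +
          ∫ s in Ioc (-1 : ℝ) 1, K * X ^ p * (X⁻¹ * ((1 + |s / X|) ^ 2)⁻¹) := by
        rw [integral_add (integrable_const _) hint.restrict]
        simp
        ring_nf
    _ ≤ 2 * K * X ^ (M + 2) + ∫ s, K * X ^ p * (X⁻¹ * ((1 + |s / X|) ^ 2)⁻¹) := by
        refine add_le_add_right (setIntegral_le_integral hint (Eventually.of_forall fun s => ?_)) _
        simp only [Pi.zero_apply]; positivity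
    _ = 2 * K * X ^ (M + 2) + K * X ^ p * J := by
        rw [integral_const_mul, integral_const_mul,
          Measure.integral_comp_div (fun v : ℝ => ((1 + |v|) ^ 2)⁻¹) X, abs_of_pos hX, ← hJ,
          smul_eq_mul, inv_mul_cancel_left₀ hX.ne']
    _ ≤ 2 * K * ((1 + C) ^ (M + 2) * X ^ p) + K * X ^ p * J := by gcongr
    _ = _ := by ring

theorem pow_le_one_add_rpow {A p : ℝ} (hA : 0 < A) {k : ℕ} (hk : (k : ℝ) ≤ p) :
    A ^ k ≤ 1 + A ^ p := by
  have hp := Real.rpow_pos_of_pos hA p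
  rcases le_or_gt A 1 with h | h
  · linarith [pow_le_one₀ (n := k) hA.le h]
  · have := Real.rpow_le_rpow_of_exponent_le h.le hk
    rw [Real.rpow_natCast] at this
    linarith

theorem integrable_hFun_mul {X : ℝ} (hX : 0 < X) {φ : ℝ → ℝ} (hφ : Integrable φ) :
    Integrable fun s => hFun X s * φ s := by
  obtain ⟨K, -, hK⟩ := exists_hFun_le X hX
  exact hφ.bdd_mul (c := K / X) (continuous_hFun hX).aestronglyMeasurable
    (Eventually.of_forall fun s => hK X s hX le_rfl)

/-- The kernel `h(X, ·)` approximates the Dirac mass at the origin, with an error governed by the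
derivatives of the test function. -/
theorem exists_kernel_bound (M : ℕ) {C p : ℝ} (hC : 0 < C) (hp1 : (M : ℝ) ≤ p)
    (hp2 : p ≤ M + 1) :
    ∃ K : ℝ, 0 ≤ K ∧ ∀ X : ℝ, 0 < X → X ≤ C → ∀ φ : ℝ → ℝ, ContDiff ℝ (M + 1 : ℕ) φ →
      Integrable φ → ∀ A B : ℝ, 0 < A →
      (∀ k ≤ M + 1, ∀ s, |iteratedDeriv k φ s| ≤ A ^ k * B) →
      |(∫ s, hFun X s * φ s) - φ 0| ≤
        K * (X ^ p * (B * (1 + A ^ p)) + X ^ (M + 1) * ∫ s, |φ s|) := by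
  have hp0 : 0 ≤ p := (Nat.cast_nonneg M).trans hp1
  obtain ⟨K₁, hK₁0, hK₁⟩ := exists_hFun_tail_bound (M + 1) hC
  obtain ⟨K₂, hK₂0, hK₂⟩ := exists_weighted_integral_bound (M + 1) hC hp0
    (by exact_mod_cast hp2)
  choose K₃ hK₃0 hK₃ using fun k : ℕ => exists_moment_bound k (N := M + 1) (by omega)
  set S := ∑ k ∈ Finset.range (M + 1), K₃ k with hS
  have hS0 : 0 ≤ S := Finset.sum_nonneg fun k _ => hK₃0 k
  refine ⟨K₁ + (2 * K₂ + S * (1 + C)), by positivity, fun X hX hXC φ hφ hφi A B hA hD => ?_⟩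
  have hB0 : 0 ≤ B := (abs_nonneg _).trans (by simpa using hD 0 (by omega) 0)
  have hcont := continuous_hFun hX
  have hint := integrable_hFun_mul hX hφi
  set c : ℕ → ℝ := fun k => iteratedDeriv k φ 0 / k.factorial with hc
  set P : ℝ → ℝ := fun s => ∑ k ∈ Finset.range (M + 1), c k * s ^ k with hP
  have hcb : ∀ k ≤ M, |c k| ≤ B * (1 + A ^ p) := by
    intro k hk
    have hk' : (k : ℝ) ≤ p := le_trans (by exact_mod_cast hk) hp1
    rw [hc]
    simp only [abs_div, Nat.abs_cast]
    refine (div_le_self (abs_nonneg _) (one_le_factorial_cast _)).trans ((hD k (by omega) 0).trans ?_)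
    rw [mul_comm]
    exact mul_le_mul_of_nonneg_left (pow_le_one_add_rpow hA hk') hB0
  have hXM : X ^ (M + 1) ≤ (1 + C) * X ^ p := by
    have h1 : X ^ (M + 1) = X ^ ((M + 1 : ℕ) - p : ℝ) * X ^ p := by
      rw [← Real.rpow_add hX, sub_add_cancel, Real.rpow_natCast]
    rw [h1]
    gcongr
    calc X ^ ((M + 1 : ℕ) - p : ℝ) ≤ (1 + C) ^ ((M + 1 : ℕ) - p : ℝ) := by
          refine Real.rpow_le_rpow hX.le (by linarith) ?_
          push_cast; linarith
      _ ≤ (1 + C) ^ (1 : ℝ) :=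
          Real.rpow_le_rpow_of_exponent_le (by linarith) (by push_cast; linarith)
      _ = _ := Real.rpow_one _
  have hIoc : ∀ f : ℝ → ℝ, Continuous f → IntegrableOn f (Ioc (-1) 1) := fun f hf =>
    (hf.integrableOn_Icc).mono_set Ioc_subset_Icc_self
  have hPc : Continuous P := by fun_prop
  have hR : ∫ s in Ioc (-1 : ℝ) 1, hFun X s * φ s
      = (∫ s in Ioc (-1 : ℝ) 1, hFun X s * (φ s - P s)) +
        ∑ k ∈ Finset.range (M + 1), c k * ∫ s in (-1 : ℝ)..1, s ^ k * hFun X s := by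
    have h1 : ∑ k ∈ Finset.range (M + 1), c k * ∫ s in (-1 : ℝ)..1, s ^ k * hFun X s
        = ∫ s in Ioc (-1 : ℝ) 1, hFun X s * P s := by
      have : ∀ s, hFun X s * P s = ∑ k ∈ Finset.range (M + 1), c k * (s ^ k * hFun X s) := by
        intro s; simp only [hP, Finset.mul_sum]
        exact Finset.sum_congr rfl fun k _ => by ring
      simp only [this]
      rw [integral_finsetSum]
      · refine Finset.sum_congr rfl fun k _ => ?_
        rw [intervalIntegral.integral_of_le (by norm_num), integral_const_mul]
      · exact fun k _ => hIoc _ (by fun_prop)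
    rw [h1, ← integral_add]
    · exact integral_congr_ae (Eventually.of_forall fun s => by simp only; ring)
    · exact hIoc _ (hcont.mul (hφ.continuous.sub hPc))
    · exact hIoc _ (hcont.mul hPc)
  have hφ0 : φ 0 = ∑ k ∈ Finset.range (M + 1), c k * if k = 0 then 1 else 0 := by
    simp [hc]
  have hsplit := integral_add_compl (measurableSet_Ioc (a := (-1 : ℝ)) (b := 1)) hint
  -- Three sources of error: the tail outside `[-1, 1]`, the Taylor remainder inside it, and the
  -- defect of the moments of `h` from those of a Dirac mass.
  have hdecomp : (∫ s, hFun X s * φ s) - φ 0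
      = (∫ s in (Ioc (-1 : ℝ) 1)ᶜ, hFun X s * φ s) +
        ((∫ s in Ioc (-1 : ℝ) 1, hFun X s * (φ s - P s)) +
        ∑ k ∈ Finset.range (M + 1), c k * ((∫ s in (-1 : ℝ)..1, s ^ k * hFun X s) -
          if k = 0 then 1 else 0)) := by
    rw [← hsplit, hR]
    simp only [mul_sub, Finset.sum_sub_distrib]
    rw [← hφ0]; ring
  have hb1 : |∫ s in (Ioc (-1 : ℝ) 1)ᶜ, hFun X s * φ s| ≤ K₁ * X ^ (M + 1) * ∫ s, |φ s| := by
    calc |∫ s in (Ioc (-1 : ℝ) 1)ᶜ, hFun X s * φ s|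
        ≤ ∫ s in (Ioc (-1 : ℝ) 1)ᶜ, |hFun X s * φ s| := abs_integral_le_integral_abs
      _ ≤ ∫ s in (Ioc (-1 : ℝ) 1)ᶜ, K₁ * X ^ (M + 1) * |φ s| := by
        refine setIntegral_mono_on hint.abs.integrableOn (hφi.abs.const_mul _).integrableOn
          measurableSet_Ioc.compl fun s hs => ?_
        rw [abs_mul]
        gcongr
        refine hK₁ X s hX hXC ?_
        by_contra h
        have := abs_lt.1 (not_le.1 h)
        exact hs ⟨this.1, this.2.le⟩
      _ ≤ ∫ s, K₁ * X ^ (M + 1) * |φ s| := setIntegral_le_integral (hφi.abs.const_mul _)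
          (Eventually.of_forall fun s => by simp only [Pi.zero_apply]; positivity)
      _ = _ := integral_const_mul _ _
  have hb2 : |∫ s in Ioc (-1 : ℝ) 1, hFun X s * (φ s - P s)| ≤
      2 * B * A ^ p * (K₂ * X ^ p) := by
    calc |∫ s in Ioc (-1 : ℝ) 1, hFun X s * (φ s - P s)|
        ≤ ∫ s in Ioc (-1 : ℝ) 1, |hFun X s * (φ s - P s)| := abs_integral_le_integral_abs
      _ ≤ ∫ s in Ioc (-1 : ℝ) 1, 2 * B * A ^ p * (|s| ^ p * |hFun X s|) := by
        refine setIntegral_mono_on (hIoc _ (hcont.mul (hφ.continuous.sub hPc)).abs)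
          (hIoc _ (continuous_const.mul ((continuous_abs.rpow_const fun _ => Or.inr hp0).mul
            hcont.abs))) measurableSet_Ioc fun s _ => ?_
        rw [abs_mul, mul_comm]
        have := abs_sub_taylor_le_rpow hφ hA hp1 hp2 hD s
        calc |φ s - P s| * |hFun X s| ≤ 2 * B * (A ^ p * |s| ^ p) * |hFun X s| := by gcongr
          _ = _ := by ring
      _ = 2 * B * A ^ p * ∫ s in Ioc (-1 : ℝ) 1, |s| ^ p * |hFun X s| := integral_const_mul _ _
      _ ≤ _ := by gcongr; exact hK₂ X hX hXC
  have hb3 : |∑ k ∈ Finset.range (M + 1), c k * ((∫ s in (-1 : ℝ)..1, s ^ k * hFun X s) -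
      if k = 0 then 1 else 0)| ≤ B * (1 + A ^ p) * (S * X ^ (M + 1)) := by
    refine (Finset.abs_sum_le_sum_abs _ _).trans ?_
    rw [hS, Finset.sum_mul, Finset.mul_sum]
    refine Finset.sum_le_sum fun k hk => ?_
    rw [abs_mul]
    have := hcb k (Nat.lt_succ_iff.1 (Finset.mem_range.1 hk))
    gcongr
    exact hK₃ k X hX
  rw [hdecomp]
  refine (abs_add_le _ _).trans ((add_le_add hb1 ((abs_add_le _ _).trans
    (add_le_add hb2 hb3))).trans ?_)
  have hφn : 0 ≤ ∫ s, |φ s| := integral_nonneg fun s => abs_nonneg _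
  have hAp : 0 < A ^ p := Real.rpow_pos_of_pos hA p
  have hXp : 0 < X ^ p := Real.rpow_pos_of_pos hX p
  have e1 : 2 * B * A ^ p * (K₂ * X ^ p) ≤ 2 * K₂ * (X ^ p * (B * (1 + A ^ p))) := by
    nlinarith [show 0 ≤ 2 * K₂ * X ^ p * B by positivity]
  have e2 : B * (1 + A ^ p) * (S * X ^ (M + 1)) ≤ S * (1 + C) * (X ^ p * (B * (1 + A ^ p))) := by
    calc B * (1 + A ^ p) * (S * X ^ (M + 1)) ≤ B * (1 + A ^ p) * (S * ((1 + C) * X ^ p)) := by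
          gcongr
      _ = _ := by ring
  have e3 : 0 ≤ K₁ * (X ^ p * (B * (1 + A ^ p))) := by positivity
  have e4 : 0 ≤ (2 * K₂ + S * (1 + C)) * (X ^ (M + 1) * ∫ s, |φ s|) := by positivity
  linarith

/-! ### The area formula for Hausdorff measure. -/

/-- Local domination of measures up to constants arbitrarily close to `1` implies domination. -/
theorem measure_le_of_locally_le {X : Type*} [TopologicalSpace X] [SecondCountableTopology X]
    [MeasurableSpace X] [OpensMeasurableSpace X] {μ ν : Measure X} {O : Set X}
    (h : ∀ c : ℝ, 1 < c → ∀ p ∈ O, ∃ V : Set X, IsOpen V ∧ p ∈ V ∧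
      ∀ A ⊆ V ∩ O, MeasurableSet A → μ A ≤ ENNReal.ofReal c * ν A)
    {A : Set X} (hAO : A ⊆ O) (hA : MeasurableSet A) : μ A ≤ ν A := by
  have key : ∀ c : ℝ, 1 < c → μ A ≤ ENNReal.ofReal c * ν A := by
    intro c hc
    choose! V hVo hVp hV using h c hc
    obtain ⟨t, htO, htc, hcov⟩ := TopologicalSpace.countable_cover_nhdsWithin (s := O) (f := V)
      fun p hp => mem_nhdsWithin_of_mem_nhds ((hVo p hp).mem_nhds (hVp p hp))
    rcases O.eq_empty_or_nonempty with hO | hO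
    · have : A = ∅ := subset_empty_iff.1 (hO ▸ hAO)
      simp [this]
    have hne : t.Nonempty := by
      obtain ⟨x, hx⟩ := hO
      obtain ⟨p, hp, -⟩ := mem_iUnion₂.1 (hcov hx)
      exact ⟨p, hp⟩
    obtain ⟨e, he⟩ := htc.exists_eq_range hne
    have heO : ∀ n, e n ∈ O := fun n => htO (he ▸ mem_range_self n)
    -- Passing to disjoint pieces lets additivity reassemble `ν A` exactly, so that the local
    -- constant `c` is not multiplied by the number of pieces.
    let W : ℕ → Set X := disjointed fun n => V (e n)
    have hWm : ∀ n, MeasurableSet (W n) :=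
      MeasurableSet.disjointed fun n => (hVo _ (heO n)).measurableSet
    have hAW : A = ⋃ n, A ∩ W n := by
      rw [← inter_iUnion, iUnion_disjointed, eq_comm, inter_eq_left]
      intro x hx
      obtain ⟨p, hp, hxp⟩ := mem_iUnion₂.1 (hcov (hAO hx))
      rw [he] at hp
      obtain ⟨n, rfl⟩ := hp
      exact mem_iUnion.2 ⟨n, hxp⟩
    have hdisj : Pairwise (Function.onFun Disjoint fun n => A ∩ W n) := fun i j hij =>
      (disjoint_disjointed _ hij).mono inter_subset_right inter_subset_right
    calc μ A = μ (⋃ n, A ∩ W n) := by rw [← hAW]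
      _ ≤ ∑' n, μ (A ∩ W n) := measure_iUnion_le _
      _ ≤ ∑' n, ENNReal.ofReal c * ν (A ∩ W n) := by
        refine ENNReal.tsum_le_tsum fun n => hV _ (heO n) _ ?_ (hA.inter (hWm n))
        exact fun x hx => ⟨disjointed_subset _ n hx.2, hAO hx.1⟩
      _ = ENNReal.ofReal c * ν A := by
        rw [ENNReal.tsum_mul_left, ← measure_iUnion hdisj fun n => hA.inter (hWm n), ← hAW]
  have hlim : Tendsto (fun c : ℝ => ENNReal.ofReal c * ν A) (𝓝[>] 1) (𝓝 (1 * ν A)) := by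
    refine ENNReal.Tendsto.mul_const ?_ (Or.inl one_ne_zero)
    rw [← ENNReal.ofReal_one]
    exact (ENNReal.continuous_ofReal.tendsto 1).mono_left nhdsWithin_le_nhds
  rw [one_mul] at hlim
  exact ge_of_tendsto hlim (eventually_nhdsWithin_of_forall key)

/-- On `A` the map `f` is a `K`-Lipschitz function of `g`: points with equal `g` have equal `f`, so
any choice of inverse for `g` may be used. -/
theorem hausdorffMeasure_image_le_of_dist_le {X Y Z : Type*} [Nonempty X] [MetricSpace Y]
    [MetricSpace Z] [MeasurableSpace Y] [BorelSpace Y] [MeasurableSpace Z] [BorelSpace Z]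
    {f : X → Y} {g : X → Z} {A : Set X} {K : NNReal}
    (h : ∀ u ∈ A, ∀ v ∈ A, dist (f u) (f v) ≤ K * dist (g u) (g v)) {d : ℝ} (hd : 0 ≤ d) :
    μH[d] (f '' A) ≤ (K : ℝ≥0∞) ^ d * μH[d] (g '' A) := by
  have hinv : ∀ y ∈ g '' A, Function.invFunOn g A y ∈ A ∧ g (Function.invFunOn g A y) = y :=
    fun y hy => ⟨Function.invFunOn_mem hy, Function.invFunOn_eq hy⟩
  have hL : LipschitzOnWith K (f ∘ Function.invFunOn g A) (g '' A) := by
    refine LipschitzOnWith.of_dist_le_mul fun y hy z hz => ?_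
    have := h _ (hinv y hy).1 _ (hinv z hz).1
    rwa [(hinv y hy).2, (hinv z hz).2] at this
  have himg : f '' A = (f ∘ Function.invFunOn g A) '' (g '' A) := by
    rw [image_image]
    refine image_congr fun x hx => ?_
    have hgx : g x ∈ g '' A := mem_image_of_mem g hx
    have h1 := h x hx _ (hinv _ hgx).1
    rw [(hinv _ hgx).2, dist_self, mul_zero] at h1
    exact dist_le_zero.1 h1
  rw [himg]
  exact hL.hausdorffMeasure_image_le hd

theorem euclideanHausdorffMeasure_image_le_of_dist_le {X Y Z : Type*} [Nonempty X] [MetricSpace Y]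
    [MetricSpace Z] [MeasurableSpace Y] [BorelSpace Y] [MeasurableSpace Z] [BorelSpace Z]
    {f : X → Y} {g : X → Z} {A : Set X} {K : ℝ} (hK : 0 ≤ K)
    (h : ∀ u ∈ A, ∀ v ∈ A, dist (f u) (f v) ≤ K * dist (g u) (g v)) (d : ℕ) :
    μHE[d] (f '' A) ≤ ENNReal.ofReal (K ^ d) * μHE[d] (g '' A) := by
  have := hausdorffMeasure_image_le_of_dist_le (K := ⟨K, hK⟩) h (Nat.cast_nonneg d)
  rw [Measure.euclideanHausdorffMeasure_def, Measure.euclideanHausdorffMeasure_def,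
    Measure.smul_apply, Measure.smul_apply, ENNReal.ofReal_pow hK]
  simp only [Measure.nnreal_smul_coe_apply] at this ⊢
  rw [mul_left_comm]
  refine mul_le_mul_right (this.trans_eq ?_) _
  rw [ENNReal.rpow_natCast, ENNReal.ofReal, Real.toNNReal_of_nonneg hK]
  rfl

/-- The area formula for a strictly differentiable parametrization of a hypersurface (or of a
submanifold of any codimension) with a measurable left inverse. -/
theorem map_restrict_euclideanHausdorffMeasure_image {U V : Type*} [NormedAddCommGroup U]
    [InnerProductSpace ℝ U] [FiniteDimensional ℝ U] [MeasurableSpace U] [BorelSpace U]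
    [NormedAddCommGroup V] [InnerProductSpace ℝ V] [MeasurableSpace V] [BorelSpace V]
    {γ : U → V} {π : V → U} {B : U → U →L[ℝ] V} {J : U → ℝ} {O : Set U} (hO : IsOpen O)
    (hπ : Measurable π) (hπγ : ∀ u ∈ O, π (γ u) = u) (hγ : ∀ u ∈ O, HasStrictFDerivAt γ (B u) u)
    (hB : ∀ u ∈ O, ∀ v, ‖v‖ ≤ ‖B u v‖) (hJ : ∀ u ∈ O, (B u).toLinearMap.normDet = J u)
    (hJ0 : ∀ u ∈ O, 0 < J u) (hJc : ContinuousOn J O) (hJm : Measurable J) :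
    ((μHE[Module.finrank ℝ U] : Measure V).restrict (γ '' O)).map π =
      (volume.restrict O).withDensity fun u => ENNReal.ofReal (J u) := by
  set d := Module.finrank ℝ U
  set μ := ((μHE[d] : Measure V).restrict (γ '' O)).map π with hμ
  set ν := (volume.restrict O).withDensity fun u => ENNReal.ofReal (J u) with hν
  have hμA : ∀ A ⊆ O, MeasurableSet A → μ A = μHE[d] (γ '' A) := by
    intro A hAO hA
    rw [hμ, Measure.map_apply hπ hA, Measure.restrict_apply (hπ hA)]
    congr 1
    ext z
    constructor
    · rintro ⟨h1, u, hu, rfl⟩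
      rw [mem_preimage, hπγ u hu] at h1
      exact ⟨u, h1, rfl⟩
    · rintro ⟨u, hu, rfl⟩
      exact ⟨by rwa [mem_preimage, hπγ u (hAO hu)], u, hAO hu, rfl⟩
  have hνA : ∀ A ⊆ O, MeasurableSet A → ν A = ∫⁻ u in A, ENNReal.ofReal (J u) := by
    intro A hAO hA
    rw [hν, withDensity_apply _ hA, Measure.restrict_restrict hA, inter_eq_left.2 hAO]
  -- Near `p` the parametrization is bi-Lipschitz to its differential at `p` with constants tending
  -- to `1`. The differential multiplies volume by exactly `J p`, and continuity of `J` replaces `J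
  -- p` by `J u`.
  have hloc : ∀ ε : ℝ, 0 < ε → ε < 1 → ∀ p ∈ O, ∃ W : Set U, IsOpen W ∧ p ∈ W ∧
      ∀ A ⊆ W ∩ O, MeasurableSet A →
        μ A ≤ ENNReal.ofReal ((1 + ε) ^ (d + 1)) * ν A ∧
        ν A ≤ ENNReal.ofReal ((1 + ε) * ((1 - ε)⁻¹) ^ d) * μ A := by
    intro ε hε hε1 p hp
    have hJp := hJ0 p hp
    have h1 := (hγ p hp).isLittleO.bound hε
    rw [nhds_prod_eq] at h1
    obtain ⟨W₁, hW₁, hW₁'⟩ := (eventually_prod_self_iff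
      (r := fun u v => ‖γ u - γ v - B p (u - v)‖ ≤ ε * ‖u - v‖)).1 h1
    have hJat := hJc.continuousAt (hO.mem_nhds hp)
    have h2 : ∀ᶠ u in 𝓝 p, J p < (1 + ε) * J u := by
      have : Tendsto (fun u => (1 + ε) * J u) (𝓝 p) (𝓝 ((1 + ε) * J p)) := hJat.const_mul _
      exact this.eventually (Ioi_mem_nhds (by nlinarith))
    have h3 : ∀ᶠ u in 𝓝 p, J u < (1 + ε) * J p := hJat.eventually (Iio_mem_nhds (by nlinarith))
    obtain ⟨W, hWsub, hWo, hpW⟩ := mem_nhds_iff.1 (inter_mem hW₁ (h2.and h3))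
    refine ⟨W, hWo, hpW, fun A hAW hA => ?_⟩
    have hAO : A ⊆ O := fun x hx => (hAW hx).2
    -- Since `B p` does not shrink vectors, the error `ε ‖u - v‖` of strict differentiability
    -- becomes a relative error with respect to the linear model.
    have hest : ∀ u ∈ A, ∀ v ∈ A, ‖γ u - γ v - B p (u - v)‖ ≤ ε * ‖B p (u - v)‖ := by
      intro u hu v hv
      refine (hW₁' u (hWsub (hAW hu).1).1 v (hWsub (hAW hv).1).1).trans ?_
      exact mul_le_mul_of_nonneg_left (hB p hp _) hε.le
    have hup : ∀ u ∈ A, ∀ v ∈ A, dist (γ u) (γ v) ≤ (1 + ε) * dist (B p u) (B p v) := by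
      intro u hu v hv
      have h5 := hest u hu v hv
      have h6 := norm_sub_norm_le (γ u - γ v) (B p (u - v))
      rw [dist_eq_norm, dist_eq_norm, ← map_sub]
      linarith
    have hlow : ∀ u ∈ A, ∀ v ∈ A, dist (B p u) (B p v) ≤ (1 - ε)⁻¹ * dist (γ u) (γ v) := by
      intro u hu v hv
      have h5 := hest u hu v hv
      have h6 := norm_sub_norm_le (B p (u - v)) (γ u - γ v)
      rw [norm_sub_rev (B p (u - v))] at h6
      rw [dist_eq_norm, dist_eq_norm, ← map_sub, inv_mul_eq_div, le_div_iff₀ (by linarith)]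
      linarith
    have e1 := euclideanHausdorffMeasure_image_le_of_dist_le (by linarith) hup d
    have e2 := euclideanHausdorffMeasure_image_le_of_dist_le (inv_nonneg.2 (by linarith)) hlow d
    have e3 : μHE[d] (B p '' A) = ENNReal.ofReal (J p) * volume A := by
      have := (B p).toLinearMap.euclideanHausdorffMeasure_image_eq_normDet_mul_volume A
      rwa [hJ p hp] at this
    have e4 : ENNReal.ofReal (J p) * volume A ≤ ENNReal.ofReal (1 + ε) * ν A := by
      rw [hνA A hAO hA, ← setLIntegral_const, ← lintegral_const_mul _ hJm.ennreal_ofReal]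
      refine setLIntegral_mono' hA fun u hu => ?_
      rw [← ENNReal.ofReal_mul (by linarith)]
      exact ENNReal.ofReal_le_ofReal (hWsub (hAW hu).1).2.1.le
    have e5 : ν A ≤ ENNReal.ofReal (1 + ε) * (ENNReal.ofReal (J p) * volume A) := by
      rw [hνA A hAO hA, ← mul_assoc, ← ENNReal.ofReal_mul (by linarith), ← setLIntegral_const]
      refine setLIntegral_mono' hA fun u hu => ?_
      exact ENNReal.ofReal_le_ofReal (hWsub (hAW hu).1).2.2.le
    rw [hμA A hAO hA]
    constructor
    · calc μHE[d] (γ '' A) ≤ ENNReal.ofReal ((1 + ε) ^ d) * (ENNReal.ofReal (1 + ε) * ν A) :=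
            e1.trans (mul_le_mul_right (e3.trans_le e4) _)
        _ = _ := by rw [← mul_assoc, ← ENNReal.ofReal_mul (by positivity), pow_succ]
    · calc ν A ≤ ENNReal.ofReal (1 + ε) * (ENNReal.ofReal ((1 - ε)⁻¹ ^ d) * μHE[d] (γ '' A)) :=
            e5.trans (mul_le_mul_right (e3.symm.trans_le e2) _)
        _ = _ := by rw [← mul_assoc, ← ENNReal.ofReal_mul (by linarith)]
  have hnull : ∀ ρ : Measure U, ρ Oᶜ = 0 → ∀ A, MeasurableSet A → ρ A = ρ (A ∩ O) := by
    intro ρ hρ A hA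
    refine le_antisymm ?_ (measure_mono inter_subset_left)
    calc ρ A ≤ ρ (A ∩ O ∪ Oᶜ) := measure_mono fun x hx => by
          by_cases h : x ∈ O
          · exact Or.inl ⟨hx, h⟩
          · exact Or.inr h
      _ ≤ ρ (A ∩ O) + ρ Oᶜ := measure_union_le _ _
      _ = ρ (A ∩ O) := by rw [hρ, add_zero]
  have hμ0 : μ Oᶜ = 0 := by
    rw [hμ, Measure.map_apply hπ hO.measurableSet.compl,
      Measure.restrict_apply (hπ hO.measurableSet.compl)]
    convert measure_empty (μ := (μHE[d] : Measure V))
    ext z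
    simp only [mem_inter_iff, mem_preimage, mem_compl_iff, mem_empty_iff_false, iff_false]
    rintro ⟨h1, u, hu, rfl⟩
    exact h1 (by rwa [hπγ u hu])
  have hν0 : ν Oᶜ = 0 := by
    refine withDensity_absolutelyContinuous _ _ ?_
    rw [Measure.restrict_apply hO.measurableSet.compl, compl_inter_self, measure_empty]
  ext A hA
  rw [hnull μ hμ0 A hA, hnull ν hν0 A hA]
  have hAO := hA.inter hO.measurableSet
  refine le_antisymm ?_ ?_
  · refine measure_le_of_locally_le (O := O) (fun c hc p hp => ?_) inter_subset_right hAO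
    have hlim : Tendsto (fun ε : ℝ => (1 + ε) ^ (d + 1)) (𝓝[>] 0) (𝓝 1) := by
      have : Continuous fun ε : ℝ => (1 + ε) ^ (d + 1) := by fun_prop
      simpa using (this.tendsto 0).mono_left nhdsWithin_le_nhds
    obtain ⟨ε, hεc, hε0, hε1⟩ := ((hlim.eventually (Iio_mem_nhds hc)).and
      (Ioo_mem_nhdsGT (show (0 : ℝ) < 1 by norm_num))).exists
    obtain ⟨W, hW, hpW, hWA⟩ := hloc ε hε0 hε1 p hp
    refine ⟨W, hW, hpW, fun A hAW hA => ((hWA A hAW hA).1).trans ?_⟩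
    exact mul_le_mul_left (ENNReal.ofReal_le_ofReal (le_of_lt hεc)) _
  · refine measure_le_of_locally_le (O := O) (fun c hc p hp => ?_) inter_subset_right hAO
    have hlim : Tendsto (fun ε : ℝ => (1 + ε) * ((1 - ε)⁻¹) ^ d) (𝓝[>] 0) (𝓝 1) := by
      have : ContinuousAt (fun ε : ℝ => (1 + ε) * ((1 - ε)⁻¹) ^ d) 0 := by
        refine ContinuousAt.mul (by fun_prop) (ContinuousAt.pow (ContinuousAt.inv₀ (by fun_prop)
          (by norm_num)) _)
      have := this.tendsto.mono_left (nhdsWithin_le_nhds (s := Ioi 0))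
      simpa using this
    obtain ⟨ε, hεc, hε0, hε1⟩ := ((hlim.eventually (Iio_mem_nhds hc)).and
      (Ioo_mem_nhdsGT (show (0 : ℝ) < 1 by norm_num))).exists
    obtain ⟨W, hW, hpW, hWA⟩ := hloc ε hε0 hε1 p hp
    refine ⟨W, hW, hpW, fun A hAW hA => ((hWA A hAW hA).2).trans ?_⟩
    exact mul_le_mul_left (ENNReal.ofReal_le_ofReal (le_of_lt hεc)) _

/-! ### Charts of the quadrics and their Jacobians. -/

variable {n : ℕ}

/-- The coordinates of `ℝ^d` other than `y i`. -/
abbrev Sp' (n : ℕ) (i : Fin n) : Type :=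
  EuclideanSpace ℝ {j : Fin n ⊕ Fin n // j ≠ Sum.inr i}

/-- The point of `ℝ^d` with coordinate `y i` equal to `s` and the other coordinates given by `u`. -/
def ins (i : Fin n) (u : Sp' n i) (s : ℝ) : Sp n :=
  WithLp.toLp 2 fun j => if h : j = Sum.inr i then s else u ⟨j, h⟩

/-- Forgetting the coordinate `y i`. -/
def del (i : Fin n) (z : Sp n) : Sp' n i := WithLp.toLp 2 fun j => z j.1

/-- The coordinate `x i`. -/
def xc (i : Fin n) (u : Sp' n i) : ℝ := u ⟨Sum.inl i, Sum.inl_ne_inr⟩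

@[simp] theorem ins_inr_self (i : Fin n) (u : Sp' n i) (s : ℝ) : ins i u s (Sum.inr i) = s := by
  simp [ins]

@[simp] theorem ins_inl (i j : Fin n) (u : Sp' n i) (s : ℝ) :
    ins i u s (Sum.inl j) = u ⟨Sum.inl j, Sum.inl_ne_inr⟩ := by
  simp [ins]

@[simp] theorem ins_coe (i : Fin n) (u : Sp' n i) (s : ℝ) (j : {j // j ≠ Sum.inr i}) :
    ins i u s j.1 = u j := by
  simp [ins, j.2]

@[simp] theorem del_ins (i : Fin n) (u : Sp' n i) (s : ℝ) : del i (ins i u s) = u := by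
  ext j; simp [del]

theorem ins_del (i : Fin n) (z : Sp n) : ins i (del i z) (z (Sum.inr i)) = z := by
  ext j
  by_cases h : j = Sum.inr i
  · simp [ins, h]
  · simp [ins, del, h]

theorem sum_ne_add (i : Fin n) (f : Fin n ⊕ Fin n → ℝ) :
    ∑ j, f j = (∑ j : {j // j ≠ Sum.inr i}, f j.1) + f (Sum.inr i) := by
  rw [← Fintype.sum_subtype_add_sum_subtype (fun j => j ≠ Sum.inr i) f]
  congr 1
  have : Unique {j : Fin n ⊕ Fin n // ¬ j ≠ Sum.inr i} :=
    ⟨⟨⟨Sum.inr i, by simp⟩⟩, fun j => Subtype.ext (not_not.1 j.2)⟩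
  rw [Fintype.sum_unique]
  exact congrArg f (not_not.1 (default : {j : Fin n ⊕ Fin n // ¬ j ≠ Sum.inr i}).2)

theorem inner_ins (i : Fin n) (u v : Sp' n i) (s t : ℝ) :
    inner ℝ (ins i u s) (ins i v t) = inner ℝ u v + s * t := by
  rw [PiLp.inner_apply, sum_ne_add i, PiLp.inner_apply]
  simp [mul_comm]

theorem norm_sq_ins (i : Fin n) (u : Sp' n i) (s : ℝ) : ‖ins i u s‖ ^ 2 = ‖u‖ ^ 2 + s ^ 2 := by
  rw [← real_inner_self_eq_norm_sq, inner_ins, real_inner_self_eq_norm_sq, sq s]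

theorem norm_le_norm_ins (i : Fin n) (u : Sp' n i) (s : ℝ) : ‖u‖ ≤ ‖ins i u s‖ := by
  refine le_of_sq_le_sq ?_ (norm_nonneg _)
  rw [norm_sq_ins]; nlinarith [sq_nonneg s]

theorem norm_A0 (z : Sp n) : ‖A0 z‖ = ‖z‖ := by
  rw [EuclideanSpace.norm_eq, EuclideanSpace.norm_eq]
  congr 1
  exact (Equiv.sumComm (Fin n) (Fin n)).sum_comp (fun j => ‖z j‖ ^ 2)

/-- `ins` as a continuous linear map. -/
def insL (i : Fin n) : Sp' n i × ℝ →L[ℝ] Sp n :=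
  LinearMap.toContinuousLinearMap
    { toFun := fun p => ins i p.1 p.2
      map_add' := fun p q => by
        ext j; by_cases h : j = Sum.inr i <;> simp [ins, h]
      map_smul' := fun c p => by
        ext j; by_cases h : j = Sum.inr i <;> simp [ins, h] }

theorem contDiff_F0 : ContDiff ℝ ∞ (F0 : Sp n → ℝ) := by
  unfold F0
  fun_prop

theorem F0_ins (i : Fin n) (u : Sp' n i) (s : ℝ) : F0 (ins i u s) = F0 (ins i u 0) + xc i u * s := by
  have h : ∀ j, ins i u s (Sum.inl j) * ins i u s (Sum.inr j) =
      ins i u 0 (Sum.inl j) * ins i u 0 (Sum.inr j) + if j = i then xc i u * s else 0 := by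
    intro j
    by_cases hj : j = i
    · subst hj; simp [xc]
    · simp [ins, hj]
  simp only [F0, h, Finset.sum_add_distrib]
  simp

theorem F0_add (z w : Sp n) : F0 (z + w) = F0 z + inner ℝ (A0 z) w + F0 w := by
  simp only [F0, A0, PiLp.inner_apply, Fintype.sum_sum_type, Sum.swap_inl, Sum.swap_inr,
    RCLike.inner_apply, conj_trivial, PiLp.add_apply]
  simp only [← Finset.sum_add_distrib]
  exact Finset.sum_congr rfl fun j _ => by ring

/-- The height function of the chart of the quadric `Σ_t` over `{x i ≠ 0}`. -/
def height (i : Fin n) (t : ℝ) (u : Sp' n i) : ℝ := (t - F0 (ins i u 0)) / xc i u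

/-- The chart of the quadric `Σ_t` over `{x i ≠ 0}`. -/
def chart (i : Fin n) (t : ℝ) (u : Sp' n i) : Sp n := ins i u (height i t u)

/-- The domain of the chart. -/
def chartDom (i : Fin n) : Set (Sp' n i) := {u | xc i u ≠ 0}

theorem continuous_xc (i : Fin n) : Continuous (xc i) := by unfold xc; fun_prop

theorem isOpen_chartDom (i : Fin n) : IsOpen (chartDom i) :=
  isOpen_ne_fun (continuous_xc i) continuous_const

theorem F0_chart {i : Fin n} {u : Sp' n i} (hu : u ∈ chartDom i) (t : ℝ) :
    F0 (chart i t u) = t := by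
  rw [chart, F0_ins, height, mul_div_cancel₀ _ hu]; ring

/-- The level equation is linear in `y i` with slope `x i`. This translation by `r / x i` is the
source of the density `|x i|⁻¹` and of the factor `|x i|⁻¹` lost with each derivative across levels.
-/
theorem chart_add (i : Fin n) (t r : ℝ) (u : Sp' n i) :
    chart i (t + r) u = ins i u (height i t u + r / xc i u) := by
  rw [chart, height, height]; congr 1; ring

theorem image_chart (i : Fin n) (t : ℝ) :
    chart i t '' chartDom i = quadric n t ∩ {z | z (Sum.inl i) ≠ 0} := by
  ext z
  constructor
  · rintro ⟨u, hu, rfl⟩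
    refine ⟨?_, ?_⟩
    · rw [quadric, mem_ofPred_eq, F0_chart hu, sub_self]
    · rw [mem_ofPred_eq, chart, ins_inl]; exact hu
  · rintro ⟨h1, h2⟩
    have hu : del i z ∈ chartDom i := h2
    refine ⟨del i z, hu, ?_⟩
    have h3 : height i t (del i z) = z (Sum.inr i) := by
      have h4 := F0_ins i (del i z) (z (Sum.inr i))
      rw [ins_del] at h4
      have h5 : F0 z = t := sub_eq_zero.1 h1
      rw [height, div_eq_iff hu]
      linarith
    rw [chart, h3, ins_del]

theorem measurable_height (i : Fin n) : Measurable fun p : ℝ × Sp' n i => height i p.1 p.2 := by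
  have h1 : Continuous fun p : ℝ × Sp' n i => F0 (ins i p.2 0) :=
    contDiff_F0.continuous.comp ((insL i).continuous.comp
      (continuous_snd.prodMk continuous_const))
  exact (measurable_fst.sub h1.measurable).div ((continuous_xc i).comp continuous_snd).measurable

theorem measurable_chart (i : Fin n) : Measurable fun p : ℝ × Sp' n i => chart i p.1 p.2 :=
  (insL i).continuous.measurable.comp (measurable_snd.prodMk (measurable_height i))

theorem measurable_chart_right (i : Fin n) (t : ℝ) : Measurable (chart i t) :=
  (measurable_chart i).comp measurable_prodMk_left

theorem contDiffAt_height {i : Fin n} {u : Sp' n i} (hu : u ∈ chartDom i) (t : ℝ) :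
    ContDiffAt ℝ ∞ (height i t) u := by
  have h1 : ContDiff ℝ ∞ fun u : Sp' n i => F0 (ins i u 0) :=
    contDiff_F0.comp ((insL i).contDiff.comp (contDiff_id.prodMk contDiff_const))
  have h2 : ContDiff ℝ ∞ (xc i) := by unfold xc; fun_prop
  exact (contDiffAt_const.sub h1.contDiffAt).div h2.contDiffAt hu

/-- The differential of the chart. -/
def chartDeriv (i : Fin n) (t : ℝ) (u : Sp' n i) : Sp' n i →L[ℝ] Sp n :=
  (insL i).comp ((ContinuousLinearMap.id ℝ _).prod (fderiv ℝ (height i t) u))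

theorem chartDeriv_apply (i : Fin n) (t : ℝ) (u v : Sp' n i) :
    chartDeriv i t u v = ins i v (fderiv ℝ (height i t) u v) := rfl

theorem hasStrictFDerivAt_chart {i : Fin n} {u : Sp' n i} (hu : u ∈ chartDom i) (t : ℝ) :
    HasStrictFDerivAt (chart i t) (chartDeriv i t u) u :=
  (insL i).hasStrictFDerivAt.comp u ((hasStrictFDerivAt_id u).prodMk
    ((contDiffAt_height hu t).hasStrictFDerivAt (by simp)))

theorem hasFDerivAt_F0 (z : Sp n) : HasFDerivAt F0 (innerSL ℝ (A0 z)) z := by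
  rw [hasFDerivAt_iff_isLittleO_nhds_zero]
  have h : (fun w : Sp n => F0 (z + w) - F0 z - innerSL ℝ (A0 z) w) = F0 := by
    ext w; rw [F0_add, innerSL_apply_apply]; ring
  rw [h]
  refine Asymptotics.IsBigO.trans_isLittleO ?_ (Asymptotics.isLittleO_norm_pow_id one_lt_two)
  refine Asymptotics.IsBigO.of_bound 1 (Eventually.of_forall fun w => ?_)
  rw [F0_eq_inner, norm_mul, norm_pow, norm_norm, one_mul]
  have h1 := norm_inner_le_norm (𝕜 := ℝ) (A0 w) w
  rw [norm_A0] at h1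
  rw [Real.norm_of_nonneg (by norm_num : (0 : ℝ) ≤ 1 / 2)]
  nlinarith [norm_nonneg (inner ℝ (A0 w) w)]

/-- Differentiation of the constant function `F0 ∘ chart`, using that the gradient of `F0` at `z` is
`A0 z` and that the `y i` coordinate of `A0 z` is `x i`. -/
theorem fderiv_height {i : Fin n} {u : Sp' n i} (hu : u ∈ chartDom i) (t : ℝ) (v : Sp' n i) :
    fderiv ℝ (height i t) u v = inner ℝ (-(xc i u)⁻¹ • del i (A0 (chart i t u))) v := by
  have h1 := (hasFDerivAt_F0 (chart i t u)).comp u (hasStrictFDerivAt_chart hu t).hasFDerivAt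
  have h2 : F0 ∘ chart i t =ᶠ[𝓝 u] fun _ => t := by
    filter_upwards [(isOpen_chartDom i).mem_nhds hu] with v hv using F0_chart hv t
  have h3 := (h1.congr_of_eventuallyEq h2.symm).unique (hasFDerivAt_const t u)
  have h4 := congrArg (fun L => L v) h3
  simp only [ContinuousLinearMap.comp_apply, innerSL_apply_apply, chartDeriv_apply,
    zero_apply] at h4
  rw [← ins_del i (A0 (chart i t u)), inner_ins] at h4
  have h5 : A0 (chart i t u) (Sum.inr i) = xc i u := by simp [A0, chart, xc]
  rw [h5] at h4
  rw [inner_smul_left, conj_trivial]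
  have hx : xc i u ≠ 0 := hu
  field_simp
  linarith

/-- The Gram matrix of a graph over a hyperplane is the identity plus the rank-one matrix `a aᵀ`,
with determinant `1 + ‖a‖²`. -/
theorem normDet_ins {i : Fin n} (a : Sp' n i) (B : Sp' n i →L[ℝ] Sp n)
    (hB : ∀ v, B v = ins i v (inner ℝ a v)) : B.toLinearMap.normDet = √(1 + ‖a‖ ^ 2) := by
  classical
  rw [eq_comm, Real.sqrt_eq_iff_mul_self_eq (by positivity) (LinearMap.normDet_nonneg _), ← sq]
  have h := B.toLinearMap.normDet_sq_eq_det_gram (EuclideanSpace.basisFun _ ℝ)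
  have h2 : Matrix.gram ℝ (fun j => B.toLinearMap (EuclideanSpace.basisFun _ ℝ j)) =
      1 + Matrix.replicateCol Unit (fun j => a j) * Matrix.replicateRow Unit (fun j => a j) := by
    ext j k
    simp [Matrix.gram, hB, inner_ins, Matrix.one_apply, Matrix.mul_apply]
    have h3 : ∀ v : Sp' n i, ∀ l, inner ℝ v (EuclideanSpace.single l (1 : ℝ)) = v l := by
      intro v l; simp [EuclideanSpace.inner_single_right]
    rw [h3, h3, h3, PiLp.single_apply]
    simp only [eq_comm]
  rw [h2, Matrix.det_one_add_replicateCol_mul_replicateRow] at h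
  rw [EuclideanSpace.real_norm_sq_eq]
  simp only [dotProduct, ← sq] at h
  exact h.symm

/-- Since `1 + ‖a‖²` equals `‖A0 z‖² / x i²` and `‖A0 z‖ = ‖z‖`, the numerator is exactly what the
weight `|A₀ z|⁻¹` in `σ_∞` cancels. -/
theorem normDet_chartDeriv {i : Fin n} {u : Sp' n i} (hu : u ∈ chartDom i) (t : ℝ) :
    (chartDeriv i t u).toLinearMap.normDet = ‖chart i t u‖ / |xc i u| := by
  rw [normDet_ins _ _ fun v => by rw [chartDeriv_apply, fderiv_height hu]]
  have hx : 0 < |xc i u| := abs_pos.2 hu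
  have h5 : A0 (chart i t u) (Sum.inr i) = xc i u := by simp [A0, chart, xc]
  have h1 : ‖chart i t u‖ ^ 2 = ‖del i (A0 (chart i t u))‖ ^ 2 + |xc i u| ^ 2 := by
    rw [← norm_A0, ← ins_del i (A0 (chart i t u)), norm_sq_ins, h5, del_ins, sq_abs]
  rw [norm_smul, norm_neg, norm_inv, Real.norm_eq_abs, mul_pow, inv_pow,
    show 1 + (|xc i u| ^ 2)⁻¹ * ‖del i (A0 (chart i t u))‖ ^ 2 =
      (‖chart i t u‖ / |xc i u|) ^ 2 by rw [div_pow, h1]; field_simp; ring]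
  exact Real.sqrt_sq (by positivity)

theorem chart_ne_zero {i : Fin n} {u : Sp' n i} (hu : u ∈ chartDom i) (t : ℝ) :
    chart i t u ≠ 0 := by
  intro h
  have : chart i t u (Sum.inl i) = 0 := by rw [h]; simp
  rw [chart, ins_inl] at this
  exact hu this

theorem finrank_Sp' (i : Fin n) : Module.finrank ℝ (Sp' n i) = 2 * n - 1 := by
  rw [finrank_euclideanSpace, Fintype.card_subtype_compl, Fintype.card_subtype_eq,
    Fintype.card_sum, Fintype.card_fin, two_mul]

theorem continuous_del (i : Fin n) : Continuous (del i) := by unfold del; fun_prop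

theorem measurable_jacobian (i : Fin n) (t : ℝ) :
    Measurable fun u : Sp' n i => ‖chart i t u‖ / |xc i u| :=
  (measurable_chart_right i t).norm.div (continuous_xc i).abs.measurable

theorem restrict_quadric_eq_map (i : Fin n) (t : ℝ) :
    (μHE[2 * n - 1] : Measure (Sp n)).restrict (quadric n t ∩ {z | z (Sum.inl i) ≠ 0}) =
      ((volume.restrict (chartDom i)).withDensity
        fun u => ENNReal.ofReal (‖chart i t u‖ / |xc i u|)).map (chart i t) := by
  have h := map_restrict_euclideanHausdorffMeasure_image (γ := chart i t) (π := del i)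
    (B := chartDeriv i t) (J := fun u => ‖chart i t u‖ / |xc i u|) (isOpen_chartDom i)
    (continuous_del i).measurable (fun u _ => del_ins i u _)
    (fun u hu => hasStrictFDerivAt_chart hu t)
    (fun u _ v => by rw [chartDeriv_apply]; exact norm_le_norm_ins i v _)
    (fun u hu => normDet_chartDeriv hu t)
    (fun u hu => div_pos (norm_pos_iff.2 (chart_ne_zero hu t)) (abs_pos.2 hu))
    (ContinuousOn.div (fun u hu => (hasStrictFDerivAt_chart hu t).continuousAt.norm.continuousWithinAt)
      (continuous_xc i).abs.continuousOn fun u hu => abs_ne_zero.2 hu)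
    (measurable_jacobian i t)
  rw [finrank_Sp'] at h
  rw [← h, Measure.map_map (measurable_chart_right i t) (continuous_del i).measurable,
    image_chart]
  conv_lhs => rw [← Measure.map_id (μ := (μHE[2 * n - 1] : Measure (Sp n)).restrict _)]
  refine Measure.map_congr ?_
  have hmeas : MeasurableSet (quadric n t ∩ {z : Sp n | z (Sum.inl i) ≠ 0}) := by
    refine MeasurableSet.inter ?_ ?_
    · exact (isClosed_eq (contDiff_F0.continuous.sub continuous_const)
        continuous_const).measurableSet
    · exact (isOpen_ne_fun (by fun_prop) continuous_const).measurableSet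
  filter_upwards [ae_restrict_mem hmeas] with z hz
  rw [← image_chart] at hz
  obtain ⟨u, hu, rfl⟩ := hz
  simp only [Function.comp, id]
  rw [show del i (chart i t u) = u from del_ins i u _]

/-- The set `{x = 0}`, missed by all charts, is an `n`-dimensional subspace. It is applied with `k =
2 n - 1`, where `n ≥ 2` is needed, and with `k = 2 n`. -/
theorem euclideanHausdorffMeasure_inl_eq_zero {k : ℕ} (hk : n < k) :
    (μHE[k] : Measure (Sp n)) {z | ∀ j, z (Sum.inl j) = 0} = 0 := by
  let f : EuclideanSpace ℝ (Fin n) → Sp n :=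
    fun y => WithLp.toLp 2 (Sum.elim (fun _ => 0) fun j => y j)
  have hf : ContDiff ℝ 1 f := by
    refine contDiff_euclidean.2 fun j => ?_
    rcases j with j | j
    · exact contDiff_const
    · simp only [f, Sum.elim_inr]; fun_prop
  have hsub : {z : Sp n | ∀ j, z (Sum.inl j) = 0} ⊆ range f := by
    intro z hz
    refine ⟨WithLp.toLp 2 fun j => z (Sum.inr j), ?_⟩
    ext j
    rcases j with j | j
    · exact (hz j).symm
    · rfl
  have h0 : (μH[k] : Measure (Sp n)) {z | ∀ j, z (Sum.inl j) = 0} = 0 := by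
    have := hausdorffMeasure_of_dimH_lt (d := (k : NNReal))
      (s := {z : Sp n | ∀ j, z (Sum.inl j) = 0}) ?_
    · simpa using this
    · refine (dimH_mono hsub).trans_lt (hf.dimH_range_le.trans_lt ?_)
      rw [finrank_euclideanSpace, Fintype.card_fin]
      exact_mod_cast hk
  rw [Measure.euclideanHausdorffMeasure_def, Measure.smul_apply, h0, smul_zero]

/-! ### The singular integral and Lebesgue measure in the charts. -/

/-- The partition of unity subordinate to the sets `{x i ≠ 0}`. -/
def rho (p : ℕ) (i : Fin n) (z : Sp n) : ℝ :=
  |z (Sum.inl i)| ^ p / ∑ j, |z (Sum.inl j)| ^ p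

/-- The density of the chart `i` of the quadrics, multiplied by the partition of unity. -/
def wt (p : ℕ) (i : Fin n) (u : Sp' n i) : ℝ := |xc i u|⁻¹ * rho p i (ins i u 0)

/-- The partition of unity depends on `x` alone, so it is constant along the fibres and comes out of
the inner integrals. -/
theorem rho_ins (p : ℕ) (i : Fin n) (u : Sp' n i) (s : ℝ) :
    rho p i (ins i u s) = rho p i (ins i u 0) := by
  simp [rho]

theorem rho_nonneg (p : ℕ) (i : Fin n) (z : Sp n) : 0 ≤ rho p i z := by
  unfold rho; positivity

theorem rho_le_one (p : ℕ) (i : Fin n) (z : Sp n) : rho p i z ≤ 1 := by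
  refine div_le_one_of_le₀ ?_ (by positivity)
  exact Finset.single_le_sum (f := fun j => |z (Sum.inl j)| ^ p) (fun j _ => by positivity)
    (Finset.mem_univ i)

theorem rho_eq_zero {p : ℕ} (hp : p ≠ 0) {i : Fin n} {z : Sp n} (hz : z (Sum.inl i) = 0) :
    rho p i z = 0 := by
  rw [rho, hz, abs_zero, zero_pow hp, zero_div]

theorem sum_rho {p : ℕ} {z : Sp n} (hz : ∃ j, z (Sum.inl j) ≠ 0) : ∑ i, rho p i z = 1 := by
  simp only [rho]
  rw [← Finset.sum_div]
  refine div_self (ne_of_gt ?_)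
  obtain ⟨j, hj⟩ := hz
  exact Finset.sum_pos' (fun i _ => by positivity) ⟨j, Finset.mem_univ j, by positivity⟩

theorem measurable_rho (p : ℕ) (i : Fin n) : Measurable (rho p i : Sp n → ℝ) := by
  unfold rho
  exact Measurable.div (by fun_prop) (by fun_prop)

theorem wt_nonneg (p : ℕ) (i : Fin n) (u : Sp' n i) : 0 ≤ wt p i u :=
  mul_nonneg (inv_nonneg.2 (abs_nonneg _)) (rho_nonneg _ _ _)

theorem wt_eq_zero {p : ℕ} {i : Fin n} {u : Sp' n i} (hu : u ∉ chartDom i) :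
    wt p i u = 0 := by
  rw [wt, not_not.1 hu, abs_zero, inv_zero, zero_mul]

theorem measurable_wt (p : ℕ) (i : Fin n) : Measurable (wt p i : Sp' n i → ℝ) := by
  unfold wt
  refine (continuous_xc i).abs.measurable.inv.mul ((measurable_rho p i).comp ?_)
  exact ((insL i).continuous.comp (continuous_id.prodMk continuous_const)).measurable

theorem measurableSet_inl_ne (i : Fin n) : MeasurableSet {z : Sp n | z (Sum.inl i) ≠ 0} :=
  (isOpen_ne_fun (by fun_prop) continuous_const).measurableSet

/-- The Jacobian `‖z‖ / |x i|` meets the factor `‖A0 z‖⁻¹ = ‖z‖⁻¹`, and only `|x i|⁻¹` remains.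
Points with `x i = 0` carry no weight because `rho` vanishes there. -/
theorem integrable_and_integral_rho_quadric {p : ℕ} (hp : p ≠ 0) (i : Fin n) (t : ℝ)
    {w : Sp n → ℝ} (hw : Measurable w) (hint : Integrable fun u => wt p i u * w (chart i t u)) :
    Integrable (fun z => rho p i z * (w z * ‖A0 z‖⁻¹))
      ((μHE[2 * n - 1] : Measure (Sp n)).restrict (quadric n t)) ∧
    ∫ z in quadric n t, rho p i z * (w z * ‖A0 z‖⁻¹) ∂(μHE[2 * n - 1] : Measure (Sp n)) =
      ∫ u, wt p i u * w (chart i t u) := by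
  set S : Set (Sp n) := {z | z (Sum.inl i) ≠ 0} with hS
  set f : Sp n → ℝ := fun z => rho p i z * (w z * ‖A0 z‖⁻¹) with hf
  have hfm : Measurable f := by
    have : Measurable fun z : Sp n => ‖A0 z‖⁻¹ := by
      simp only [norm_A0]; exact measurable_norm.inv
    exact (measurable_rho p i).mul (hw.mul this)
  have hfS : f = S.indicator f := by
    ext z
    by_cases hz : z ∈ S
    · rw [indicator_of_mem hz]
    · rw [indicator_of_notMem hz, hf]
      simp only
      rw [rho_eq_zero hp (not_not.1 hz), zero_mul]
  have hSm : MeasurableSet S := measurableSet_inl_ne i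
  have hres : ((μHE[2 * n - 1] : Measure (Sp n)).restrict (quadric n t)).restrict S =
      ((volume.restrict (chartDom i)).withDensity
        fun u => ENNReal.ofReal (‖chart i t u‖ / |xc i u|)).map (chart i t) := by
    rw [Measure.restrict_restrict hSm, inter_comm, restrict_quadric_eq_map]
  have hch := measurable_chart_right i t
  have hJm := (measurable_jacobian i t).real_toNNReal
  have hpt : ∀ u ∈ chartDom i, (‖chart i t u‖ / |xc i u|).toNNReal • f (chart i t u) =
      wt p i u * w (chart i t u) := by
    intro u hu
    rw [NNReal.smul_def, Real.coe_toNNReal _ (by positivity), hf, smul_eq_mul, wt]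
    simp only [norm_A0]
    rw [show rho p i (chart i t u) = rho p i (ins i u 0) from rho_ins p i u _]
    have h1 : ‖chart i t u‖ ≠ 0 := norm_ne_zero_iff.2 (chart_ne_zero hu t)
    field_simp
  have hdm : MeasurableSet (chartDom i) := (isOpen_chartDom i).measurableSet
  have hint' : IntegrableOn (fun u => (‖chart i t u‖ / |xc i u|).toNNReal • f (chart i t u))
      (chartDom i) :=
    hint.integrableOn.congr_fun (fun u hu => (hpt u hu).symm) hdm
  constructor
  · rw [hfS, integrable_indicator_iff hSm, IntegrableOn, hres,
      integrable_map_measure hfm.aestronglyMeasurable hch.aemeasurable]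
    exact (integrable_withDensity_iff_integrable_smul hJm).2 hint'
  · rw [hfS, integral_indicator hSm, hres,
      integral_map hch.aemeasurable hfm.aestronglyMeasurable]
    refine (integral_withDensity_eq_integral_smul hJm _).trans ?_
    rw [setIntegral_congr_fun hdm hpt]
    refine setIntegral_eq_integral_of_forall_compl_eq_zero fun u hu => ?_
    rw [wt_eq_zero hu, zero_mul]

/-- The singular integral in the charts of the quadric. -/
theorem sigmaInf_eq_sum (hn : 2 ≤ n) {p : ℕ} (hp : p ≠ 0) (t : ℝ) {w : Sp n → ℝ}
    (hw : Measurable w) (hint : ∀ i, Integrable fun u => wt p i u * w (chart i t u)) :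
    sigmaInf n w t = ∑ i, ∫ u, wt p i u * w (chart i t u) := by
  have h := fun i => integrable_and_integral_rho_quadric hp i t hw (hint i)
  rw [sigmaInf, ← Finset.sum_congr rfl fun i _ => (h i).2,
    ← integral_finsetSum _ fun i _ => (h i).1]
  refine integral_congr_ae ?_
  have hnull : ∀ᵐ z ∂((μHE[2 * n - 1] : Measure (Sp n)).restrict (quadric n t)),
      ∃ j, z (Sum.inl j) ≠ 0 := by
    refine ae_restrict_of_ae ?_
    rw [ae_iff]
    simpa using euclideanHausdorffMeasure_inl_eq_zero (n := n) (k := 2 * n - 1) (by omega)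
  filter_upwards [hnull] with z hz
  rw [← Finset.sum_mul, sum_rho hz, one_mul]

theorem measurePreserving_ins (i : Fin n) :
    MeasurePreserving (fun q : Sp' n i × ℝ => ins i q.1 q.2) (volume.prod volume) volume := by
  have : Unique {j : Fin n ⊕ Fin n // ¬ j ≠ Sum.inr i} :=
    ⟨⟨⟨Sum.inr i, by simp⟩⟩, fun j => Subtype.ext (not_not.1 j.2)⟩
  have h0 : MeasurePreserving
      (MeasurableEquiv.funUnique {j : Fin n ⊕ Fin n // ¬ j ≠ Sum.inr i} ℝ) := by
    convert volume_preserving_funUnique {j : Fin n ⊕ Fin n // ¬ j ≠ Sum.inr i} ℝ <;> rfl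
  have h1 : MeasurePreserving (fun q : Sp' n i × ℝ => (WithLp.ofLp q.1,
      (MeasurableEquiv.funUnique {j : Fin n ⊕ Fin n // ¬ j ≠ Sum.inr i} ℝ).symm q.2))
      (volume.prod volume) (volume.prod volume) :=
    (PiLp.volume_preserving_ofLp _).prod (h0.symm _)
  have h2 := (volume_preserving_piEquivPiSubtypeProd (fun _ : Fin n ⊕ Fin n => ℝ)
    (fun j => j ≠ Sum.inr i)).symm _
  have h3 := PiLp.volume_preserving_toLp (Fin n ⊕ Fin n)
  have h := h3.comp (h2.comp h1)
  suffices hfun : (fun q : Sp' n i × ℝ => ins i q.1 q.2) = WithLp.toLp 2 ∘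
      (MeasurableEquiv.piEquivPiSubtypeProd (fun _ => ℝ) fun j => j ≠ Sum.inr i).symm ∘
      fun q => (q.1.ofLp, (MeasurableEquiv.funUnique {j // ¬ j ≠ Sum.inr i} ℝ).symm q.2) by
    rw [hfun]; exact h
  funext q
  ext j
  by_cases hj : j = Sum.inr i
  · simp [ins, hj, MeasurableEquiv.piEquivPiSubtypeProd, Equiv.piEquivPiSubtypeProd,
      MeasurableEquiv.funUnique]
  · simp [ins, hj, MeasurableEquiv.piEquivPiSubtypeProd, Equiv.piEquivPiSubtypeProd]

theorem integral_slice {F : Sp n → ℝ} {i : Fin n} {u : Sp' n i} (hu : u ∈ chartDom i) (t : ℝ) :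
    ∫ s, F (ins i u s) = |xc i u|⁻¹ * ∫ r, F (chart i (t + r) u) := by
  have hx : |xc i u| ≠ 0 := abs_ne_zero.2 hu
  have h1 := Measure.integral_comp_div (fun s => F (ins i u (height i t u + s))) (xc i u)
  rw [integral_add_left_eq_self (fun s => F (ins i u s)), smul_eq_mul] at h1
  simp only [chart_add]
  rw [h1, inv_mul_cancel_left₀ hx]

theorem integrable_slice {F : Sp n → ℝ} {i : Fin n} {u : Sp' n i} (hu : u ∈ chartDom i) (t : ℝ)
    (hF : Integrable fun s => F (ins i u s)) : Integrable fun r => F (chart i (t + r) u) := by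
  simp only [chart_add]
  exact ((hF.comp_add_left (height i t u)).comp_div (R := xc i u) hu)

theorem integrable_ins {F : Sp n → ℝ} (hF : Integrable F) (i : Fin n) :
    Integrable (fun q : Sp' n i × ℝ => F (ins i q.1 q.2)) (volume.prod volume) :=
  (measurePreserving_ins i).integrable_comp_of_integrable hF

theorem ae_integrable_chart {F : Sp n → ℝ} (hF : Integrable F) (i : Fin n) (t : ℝ) :
    ∀ᵐ u : Sp' n i, u ∈ chartDom i → Integrable fun r => F (chart i (t + r) u) := by
  filter_upwards [(integrable_ins hF i).prod_right_ae] with u hu hud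
  exact integrable_slice hud t hu

/-- Disintegration of Lebesgue measure along the charts of the quadrics. -/
theorem integrable_and_integral_rho {p : ℕ} (hp : p ≠ 0) {F : Sp n → ℝ} (hF : Integrable F)
    (i : Fin n) (t : ℝ) :
    Integrable (fun u => wt p i u * ∫ r, F (chart i (t + r) u)) ∧
    ∫ z, rho p i z * F z = ∫ u, wt p i u * ∫ r, F (chart i (t + r) u) := by
  have hG : Integrable fun z => rho p i z * F z :=
    hF.bdd_mul (c := 1) (measurable_rho p i).aestronglyMeasurable
      (Eventually.of_forall fun z => by
        rw [Real.norm_of_nonneg (rho_nonneg p i z)]; exact rho_le_one p i z)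
  have h1 := integrable_ins hG i
  have hpt : ∀ u : Sp' n i, ∫ s, rho p i (ins i u s) * F (ins i u s) =
      wt p i u * ∫ r, F (chart i (t + r) u) := by
    intro u
    simp only [rho_ins p i u]
    rw [integral_const_mul]
    by_cases hu : u ∈ chartDom i
    · rw [integral_slice hu t, wt]; ring
    · rw [wt_eq_zero hu, rho_eq_zero hp, zero_mul, zero_mul]
      rw [ins_inl]; exact not_not.1 hu
  constructor
  · exact h1.integral_prod_left.congr (Eventually.of_forall hpt)
  · rw [← (measurePreserving_ins i).map_eq, integral_map]
    · rw [← integral_congr_ae (Eventually.of_forall hpt)]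
      exact integral_prod _ h1
    · exact (measurePreserving_ins i).measurable.aemeasurable
    · rw [(measurePreserving_ins i).map_eq]; exact hG.aestronglyMeasurable

theorem integral_eq_sum_chart (hn : 1 ≤ n) {p : ℕ} (hp : p ≠ 0) {F : Sp n → ℝ}
    (hF : Integrable F) (t : ℝ) :
    ∫ z, F z = ∑ i, ∫ u, wt p i u * ∫ r, F (chart i (t + r) u) := by
  rw [← Finset.sum_congr rfl fun i _ => (integrable_and_integral_rho hp hF i t).2,
    ← integral_finsetSum]
  · refine integral_congr_ae ?_
    have hnull : ∀ᵐ z : Sp n, ∃ j, z (Sum.inl j) ≠ 0 := by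
      rw [ae_iff, ← InnerProductSpace.euclideanHausdorffMeasure_eq_volume]
      simpa using euclideanHausdorffMeasure_inl_eq_zero (n := n) (k := Module.finrank ℝ (Sp n))
        (by rw [finrank_euclideanSpace, Fintype.card_sum, Fintype.card_fin]; omega)
    filter_upwards [hnull] with z hz
    rw [← Finset.sum_mul, sum_rho hz, one_mul]
  · exact fun i _ => hF.bdd_mul (c := 1) (measurable_rho p i).aestronglyMeasurable
      (Eventually.of_forall fun z => by
        rw [Real.norm_of_nonneg (rho_nonneg p i z)]; exact rho_le_one p i z)

/-! ### Integrability of the singular chart weights. -/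

theorem integrable_comp_abs_of_integrableOn_Ioi {f : ℝ → ℝ} (hf : IntegrableOn f (Ioi 0)) :
    Integrable fun x => f |x| := by
  have h1 : IntegrableOn (fun x => f |x|) (Ioi 0) :=
    hf.congr_fun (fun x hx => by rw [abs_of_pos hx]) measurableSet_Ioi
  have h2 : IntegrableOn (fun x => f |x|) (Iic 0) := by
    rw [← Measure.map_neg_eq_self (volume : Measure ℝ)]
    have m : MeasurableEmbedding fun x : ℝ => -x := (Homeomorph.neg ℝ).measurableEmbedding
    rw [m.integrableOn_map_iff]
    simp_rw [Function.comp_def, abs_neg, neg_preimage, neg_Iic, neg_zero]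
    exact Iff.mpr integrableOn_Ici_iff_integrableOn_Ioi h1
  rw [← integrableOn_univ, ← Iic_union_Ioi (a := (0 : ℝ))]
  exact h2.union h1

theorem integrable_rpow_mul_max_rpow {b c : ℝ} (hb : b < 1) (hbc : 1 < b + c) :
    Integrable fun x : ℝ => |x| ^ (-b) * (max 1 |x|) ^ (-c) := by
  refine integrable_comp_abs_of_integrableOn_Ioi (f := fun x => x ^ (-b) * (max 1 x) ^ (-c)) ?_
  rw [← Ioc_union_Ioi_eq_Ioi zero_le_one]
  refine IntegrableOn.union ?_ ?_
  · have h := (intervalIntegral.intervalIntegrable_rpow' (a := 0) (b := 1)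
      (show -1 < -b by linarith)).1
    refine h.congr_fun (fun x hx => ?_) measurableSet_Ioc
    simp only [max_eq_left hx.2, Real.one_rpow, mul_one]
  · have h := integrableOn_Ioi_rpow_of_lt (show -(b + c) < -1 by linarith) zero_lt_one
    refine h.congr_fun (fun x hx => ?_) measurableSet_Ioi
    have hx1 : (1 : ℝ) < x := hx
    simp only [max_eq_right hx1.le]
    rw [← Real.rpow_add (by linarith)]
    congr 1; ring

theorem prod_ne_mul (i : Fin n) (f : Fin n ⊕ Fin n → ℝ) :
    ∏ j, f j = (∏ j : {j // j ≠ Sum.inr i}, f j.1) * f (Sum.inr i) := by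
  rw [← Fintype.prod_subtype_mul_prod_subtype (fun j => j ≠ Sum.inr i) f]
  congr 1
  have : Unique {j : Fin n ⊕ Fin n // ¬ j ≠ Sum.inr i} :=
    ⟨⟨⟨Sum.inr i, by simp⟩⟩, fun j => Subtype.ext (not_not.1 j.2)⟩
  rw [Fintype.prod_unique]
  exact congrArg f (not_not.1 (default : {j : Fin n ⊕ Fin n // ¬ j ≠ Sum.inr i}).2)

/-- The denominator of `rho` dominates `|x i|^p` and `|x j|^p`; the first is used when `|x j| ≤ |x
i|`, the second otherwise, where `p ≥ 1 + a` makes the numerator increasing. The freedom in `j`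
replaces a singularity on `x i = 0` by one at `x = 0`. -/
theorem wt_mul_rpow_le {p : ℕ} {a : ℝ} (ha0 : 0 ≤ a) (hap : a ≤ p - 1) (i j : Fin n)
    {u : Sp' n i} (hu : u ∈ chartDom i) (hj : ins i u 0 (Sum.inl j) ≠ 0) :
    wt p i u * |xc i u| ^ (-a) ≤ |ins i u 0 (Sum.inl j)| ^ (-(1 + a)) := by
  set z := ins i u 0 with hz
  have hx : 0 < |xc i u| := abs_pos.2 hu
  have hxz : |z (Sum.inl i)| = |xc i u| := by rw [hz, ins_inl]; rfl
  have hy : 0 < |z (Sum.inl j)| := abs_pos.2 hj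
  have hS : ∀ k, |z (Sum.inl k)| ^ p ≤ ∑ k, |z (Sum.inl k)| ^ p := fun k =>
    Finset.single_le_sum (f := fun j => |z (Sum.inl j)| ^ p) (fun j _ => by positivity)
      (Finset.mem_univ k)
  have hw : wt p i u * |xc i u| ^ (-a) =
      |xc i u| ^ ((p : ℝ) - (1 + a)) / ∑ k, |z (Sum.inl k)| ^ p := by
    rw [wt, ← hz, rho, hxz, Real.rpow_sub hx, Real.rpow_natCast, Real.rpow_add hx, Real.rpow_one,
      Real.rpow_neg hx.le]
    field_simp
  rw [hw]
  have hkey : ∀ y : ℝ, 0 < y → y ^ ((p : ℝ) - (1 + a)) / y ^ p = y ^ (-(1 + a)) := by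
    intro y hy
    rw [← Real.rpow_natCast, ← Real.rpow_sub hy]
    congr 1; ring
  rcases le_or_gt |z (Sum.inl j)| |xc i u| with h | h
  · calc |xc i u| ^ ((p : ℝ) - (1 + a)) / ∑ k, |z (Sum.inl k)| ^ p
        ≤ |xc i u| ^ ((p : ℝ) - (1 + a)) / |xc i u| ^ p := by
          gcongr; rw [← hxz]; exact hS i
      _ = |xc i u| ^ (-(1 + a)) := hkey _ hx
      _ ≤ _ := Real.rpow_le_rpow_of_nonpos hy h (by linarith)
  · calc |xc i u| ^ ((p : ℝ) - (1 + a)) / ∑ k, |z (Sum.inl k)| ^ p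
        ≤ |z (Sum.inl j)| ^ ((p : ℝ) - (1 + a)) / |z (Sum.inl j)| ^ p := by
          gcongr
          · linarith
          · exact hS j
      _ = _ := hkey _ hy

/-- The one-variable majorants of the chart densities. -/
def majorant (β : ℝ) : Fin n ⊕ Fin n → ℝ → ℝ :=
  Sum.elim (fun _ x => |x| ^ (-β) * (max 1 |x|) ^ (-(1 - β / 2)))
    fun _ x => |x| ^ (-0 : ℝ) * (max 1 |x|) ^ (-(1 + β / 2))

theorem integrable_majorant {β : ℝ} (hβ0 : 0 < β) (hβ1 : β < 1) (j : Fin n ⊕ Fin n) :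
    Integrable (majorant β j) := by
  rcases j with j | j
  · exact integrable_rpow_mul_max_rpow hβ1 (by linarith)
  · exact integrable_rpow_mul_max_rpow zero_lt_one (by linarith)

/-- The geometric mean of `wt_mul_rpow_le` over `j` spreads the singularity as `|x j|^(-β)` with `β
= (1 + a) / n`, and the decay in `‖u‖` is likewise split among the coordinates. This reduces
integrability to one variable at a time. -/
theorem wt_mul_rpow_mul_le_prod {p : ℕ} {a : ℝ} (hn : 0 < n) (ha0 : 0 ≤ a) (hap : a ≤ p - 1)
    (han : 1 + a ≤ n) (i : Fin n) {u : Sp' n i} (hu : ∀ j, u j ≠ 0) :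
    wt p i u * |xc i u| ^ (-a) * (max 1 ‖u‖) ^ (-(2 * n - 1 : ℝ)) ≤
      ∏ j, majorant ((1 + a) / n) j.1 (u j) := by
  have hn' : (0 : ℝ) < n := by exact_mod_cast hn
  have hn0 : (n : ℝ) ≠ 0 := hn'.ne'
  set β : ℝ := (1 + a) / n with hβ
  have hβ0 : 0 < β := by positivity
  have hβ1 : β ≤ 1 := (div_le_one hn').2 han
  have hβn : n * β = 1 + a := by rw [hβ]; field_simp
  have hz : ∀ j, ins i u 1 j ≠ 0 := by
    intro j
    by_cases hj : j = Sum.inr i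
    · subst hj; simp
    · have := hu ⟨j, hj⟩
      rwa [← ins_coe i u 1 ⟨j, hj⟩] at this
  set E := wt p i u * |xc i u| ^ (-a) with hE
  have hE0 : 0 ≤ E := mul_nonneg (wt_nonneg _ _ _) (by positivity)
  have h1 : E ≤ ∏ j : {j // j ≠ Sum.inr i},
      Sum.elim (fun j => |ins i u 1 (Sum.inl j)| ^ (-β)) (fun _ => (1 : ℝ)) j.1 := by
    have h2 := prod_ne_mul i (Sum.elim (fun j => |ins i u 1 (Sum.inl j)| ^ (-β)) fun _ => (1 : ℝ))
    rw [Sum.elim_inr, mul_one] at h2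
    rw [← h2, Fintype.prod_sum_type]
    simp only [Sum.elim_inl, Sum.elim_inr, Finset.prod_const_one, mul_one]
    have h3 : E = ∏ _j : Fin n, E ^ ((1 : ℝ) / n) := by
      rw [Finset.prod_const, Finset.card_univ, Fintype.card_fin, ← Real.rpow_natCast,
        ← Real.rpow_mul hE0, one_div, inv_mul_cancel₀ hn0, Real.rpow_one]
    rw [h3]
    refine Finset.prod_le_prod (fun j _ => by positivity) fun j _ => ?_
    have h4 : E ≤ |ins i u 1 (Sum.inl j)| ^ (-(1 + a)) := by
      have := wt_mul_rpow_le ha0 hap i j (u := u) (hu _) (by rw [ins_inl]; exact hu _)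
      rwa [ins_inl, ← ins_inl i j u 1] at this
    calc E ^ ((1 : ℝ) / n) ≤ (|ins i u 1 (Sum.inl j)| ^ (-(1 + a))) ^ ((1 : ℝ) / n) := by gcongr
      _ = _ := by
        rw [← Real.rpow_mul (abs_nonneg _)]
        congr 1
        rw [hβ]; ring
  -- Each `x j` already decays like `|x j|^(-β)`, so exponent `1 - β / 2` brings it to `1 + β / 2 >
  -- 1` at infinity. Each `y j`, `j ≠ i`, gets `1 + β / 2`. The total, `2 n - 1 - β / 2`, fits into
  -- the available `2 n - 1`.
  set e : Fin n ⊕ Fin n → ℝ := Sum.elim (fun _ => 1 - β / 2) fun _ => 1 + β / 2 with he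
  have he0 : ∀ j, 0 ≤ e j := by
    rintro (j | j)
    · simp only [he, Sum.elim_inl]; linarith
    · simp only [he, Sum.elim_inr]; linarith
  have h5 : (max 1 ‖u‖) ^ (-(2 * n - 1 : ℝ)) ≤
      ∏ j : {j // j ≠ Sum.inr i}, (max 1 |u j|) ^ (-e j.1) := by
    have hsum : ∑ j : {j // j ≠ Sum.inr i}, e j.1 ≤ 2 * n - 1 := by
      have h6 := sum_ne_add i e
      rw [Fintype.sum_sum_type] at h6
      simp only [he, Sum.elim_inl, Sum.elim_inr, Finset.sum_const, Finset.card_univ,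
        Fintype.card_fin, nsmul_eq_mul] at h6 ⊢
      linarith
    calc (max 1 ‖u‖) ^ (-(2 * n - 1 : ℝ))
        ≤ (max 1 ‖u‖) ^ (∑ j : {j // j ≠ Sum.inr i}, -e j.1) := by
          refine Real.rpow_le_rpow_of_exponent_le (le_max_left _ _) ?_
          rw [Finset.sum_neg_distrib]; linarith
      _ = ∏ j : {j // j ≠ Sum.inr i}, (max 1 ‖u‖) ^ (-e j.1) :=
          Real.rpow_sum_of_pos (by positivity) _ _
      _ ≤ _ := by
          refine Finset.prod_le_prod (fun j _ => by positivity) fun j _ => ?_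
          refine Real.rpow_le_rpow_of_nonpos (by positivity) ?_ (by linarith [he0 j.1])
          exact max_le_max le_rfl (PiLp.norm_apply_le u j)
  calc E * (max 1 ‖u‖) ^ (-(2 * n - 1 : ℝ))
      ≤ (∏ j : {j // j ≠ Sum.inr i},
        Sum.elim (fun j => |ins i u 1 (Sum.inl j)| ^ (-β)) (fun _ => (1 : ℝ)) j.1) *
        ∏ j : {j // j ≠ Sum.inr i}, (max 1 |u j|) ^ (-e j.1) :=
        mul_le_mul h1 h5 (by positivity) (hE0.trans h1)
    _ = _ := by
        rw [← Finset.prod_mul_distrib]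
        refine Finset.prod_congr rfl ?_
        rintro ⟨j | j, hj⟩ -
        · simp [majorant, he]
        · simp [majorant, he]

theorem ae_forall_ne_zero (i : Fin n) : ∀ᵐ u : Sp' n i, ∀ j, u j ≠ 0 := by
  rw [ae_all_iff]
  intro j
  have h : ∀ᵐ f : {j // j ≠ Sum.inr i} → ℝ, f j ≠ 0 :=
    compl_mem_ae_iff.2 (Measure.pi_hyperplane (fun _ => volume) j 0)
  exact (PiLp.volume_preserving_ofLp {j // j ≠ Sum.inr i}).quasiMeasurePreserving.ae h

theorem integrable_prod_majorant {β : ℝ} (hβ0 : 0 < β) (hβ1 : β < 1) (i : Fin n) :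
    Integrable fun u : Sp' n i => ∏ j, majorant β j.1 (u j) :=
  (PiLp.volume_preserving_ofLp {j // j ≠ Sum.inr i}).integrable_comp_of_integrable
    (Integrable.fintype_prod (f := fun j : {j // j ≠ Sum.inr i} => majorant β j.1)
      fun j => integrable_majorant hβ0 hβ1 j.1)

/-- The strict inequality `1 + a < n` means `β < 1`, that is, integrability of each one-variable
majorant at `0`. It is the restriction behind `M ≤ d/2 - 1`. -/
theorem integrable_weight {p : ℕ} {a : ℝ} (hn : 0 < n) (ha0 : 0 ≤ a) (hap : a ≤ p - 1)
    (han : 1 + a < n) (i : Fin n) :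
    Integrable fun u : Sp' n i =>
      wt p i u * |xc i u| ^ (-a) * (max 1 ‖u‖) ^ (-(2 * n - 1 : ℝ)) := by
  have hn' : (0 : ℝ) < n := by exact_mod_cast hn
  refine (integrable_prod_majorant (β := (1 + a) / n) (by positivity)
    ((div_lt_one hn').2 han) i).mono' ?_ ?_
  · refine Measurable.aestronglyMeasurable ?_
    have h1 := measurable_wt p i
    have h2 := (continuous_xc i).measurable
    have h3 : Measurable fun u : Sp' n i => ‖u‖ := measurable_norm
    exact (h1.mul ((measurable_norm.comp h2).pow_const _)).mul
      ((measurable_const.max h3).pow_const _)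
  · filter_upwards [ae_forall_ne_zero i] with u hu
    rw [Real.norm_of_nonneg (mul_nonneg (mul_nonneg (wt_nonneg _ _ _) (by positivity))
      (by positivity))]
    exact wt_mul_rpow_mul_le_prod hn ha0 hap han.le i hu

/-! ### Weighted norms and derivatives along the fibres. -/

theorem abs_iteratedFDeriv_le_wnorm {a : ℕ} {b : ℝ} {f : Sp n → ℝ} (hf : wnorm a b f ≠ ⊤) {k : ℕ}
    (hk : k ≤ a) (z : Sp n) (j : Fin k → Fin n ⊕ Fin n) :
    |iteratedFDeriv ℝ k f z (fun i => EuclideanSpace.single (j i) (1 : ℝ))| ≤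
      (wnorm a b f).toReal * (max 1 ‖z‖) ^ (-b) := by
  have hpos : 0 < (max 1 ‖z‖) ^ b := by positivity
  have h1 : ENNReal.ofReal
      (|iteratedFDeriv ℝ k f z (fun i => EuclideanSpace.single (j i) (1 : ℝ))| *
        (max 1 ‖z‖) ^ b) ≤ wnorm a b f := by
    unfold wnorm
    exact le_iSup_of_le z (le_iSup_of_le k (le_iSup_of_le hk (le_iSup_of_le j le_rfl)))
  rw [ENNReal.ofReal_le_iff_le_toReal hf] at h1
  rw [Real.rpow_neg (by positivity), ← div_eq_mul_inv, le_div_iff₀ hpos]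
  exact h1

theorem abs_le_wnorm {a : ℕ} {b : ℝ} {f : Sp n → ℝ} (hf : wnorm a b f ≠ ⊤) (z : Sp n) :
    |f z| ≤ (wnorm a b f).toReal * (max 1 ‖z‖) ^ (-b) := by
  have := abs_iteratedFDeriv_le_wnorm hf (Nat.zero_le a) z Fin.elim0
  rwa [iteratedFDeriv_zero_apply] at this

theorem max_norm_ins_rpow_le (i : Fin n) (u : Sp' n i) (s : ℝ) {b : ℝ} (hb : 0 ≤ b) :
    (max 1 ‖ins i u s‖) ^ (-b) ≤ (max 1 ‖u‖) ^ (-b) :=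
  Real.rpow_le_rpow_of_nonpos (by positivity) (max_le_max le_rfl (norm_le_norm_ins i u s))
    (by linarith)

theorem ins_eq_add_smul (i : Fin n) (u : Sp' n i) (s : ℝ) :
    ins i u s = ins i u 0 + s • EuclideanSpace.single (Sum.inr i) (1 : ℝ) := by
  ext j
  by_cases hj : j = Sum.inr i
  · subst hj; simp
  · simp [ins, hj]

/-- The restriction of a function to the fibres of the chart. -/
theorem contDiff_comp_chart {k : ℕ} {w : Sp n → ℝ} (hw : ContDiff ℝ k w) (i : Fin n)
    (t : ℝ) (u : Sp' n i) : ContDiff ℝ k fun s => w (chart i (t + s) u) := by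
  simp only [chart_add]
  refine hw.comp ((insL i).contDiff.comp (contDiff_const.prodMk ?_))
  fun_prop

/-- As the level varies with `u` fixed, the chart traces a straight line in the `y i` direction with
speed `1 / x i`. -/
theorem iteratedDeriv_comp_chart {M : ℕ} {w : Sp n → ℝ} (hw : ContDiff ℝ M w) {k : ℕ}
    (hk : k ≤ M) (i : Fin n) (t : ℝ) (u : Sp' n i) (s : ℝ) :
    iteratedDeriv k (fun s => w (chart i (t + s) u)) s = (xc i u)⁻¹ ^ k *
      iteratedFDeriv ℝ k w (chart i (t + s) u)
        (fun _ => EuclideanSpace.single (Sum.inr i) (1 : ℝ)) := by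
  set e : Sp n := EuclideanSpace.single (Sum.inr i) (1 : ℝ) with he
  set c : Sp n := chart i t u with hc
  have hline : ∀ s, chart i (t + s) u = c + ((xc i u)⁻¹ * s) • e := by
    intro s
    rw [chart_add, ins_eq_add_smul, hc, chart, ins_eq_add_smul i u (height i t u), add_assoc,
      ← add_smul, div_eq_inv_mul]
  have hwk : ContDiff ℝ k w := hw.of_le (by exact_mod_cast hk)
  have hf : ContDiff ℝ k fun v => w (c + v) := hwk.comp (by fun_prop)
  let ℓ : ℝ →L[ℝ] Sp n := ContinuousLinearMap.toSpanSingleton ℝ e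
  have h1 : (fun s => w (chart i (t + s) u)) =
      fun s => ((fun v => w (c + v)) ∘ ℓ) ((xc i u)⁻¹ * s) := by
    funext s
    simp only [Function.comp, hline, ℓ, ContinuousLinearMap.toSpanSingleton_apply]
  rw [h1, iteratedDeriv_comp_const_mul (hf.comp ℓ.contDiff)]
  simp only
  rw [iteratedDeriv_eq_iteratedFDeriv, ℓ.iteratedFDeriv_comp_right hf _ le_rfl,
    ContinuousMultilinearMap.compContinuousLinearMap_apply, iteratedFDeriv_comp_add_left, hline]
  simp [ℓ]

theorem abs_iteratedDeriv_comp_chart_le {M : ℕ} {b : ℝ} (hb : 0 ≤ b) {w : Sp n → ℝ}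
    (hw : ContDiff ℝ M w) (hfin : wnorm M b w ≠ ⊤) {k : ℕ} (hk : k ≤ M) (i : Fin n) (t : ℝ)
    (u : Sp' n i) (s : ℝ) :
    |iteratedDeriv k (fun s => w (chart i (t + s) u)) s| ≤
      |xc i u|⁻¹ ^ k * ((wnorm M b w).toReal * (max 1 ‖u‖) ^ (-b)) := by
  rw [iteratedDeriv_comp_chart hw hk, abs_mul, abs_pow, abs_inv]
  gcongr
  refine (abs_iteratedFDeriv_le_wnorm hfin hk _ fun _ => Sum.inr i).trans ?_
  exact mul_le_mul_of_nonneg_left (max_norm_ins_rpow_le i u _ hb) ENNReal.toReal_nonneg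

theorem integrable_max_norm_rpow :
    Integrable fun z : Sp n => (max 1 ‖z‖) ^ (-(2 * n + 1 : ℝ)) := by
  have h := integrable_one_add_norm (E := Sp n) (μ := volume) (r := 2 * n + 1) (by
    rw [finrank_euclideanSpace, Fintype.card_sum, Fintype.card_fin]; push_cast; linarith)
  refine (h.const_mul (2 ^ (2 * n + 1 : ℝ))).mono' ?_ (Eventually.of_forall fun z => ?_)
  · exact ((measurable_const.max measurable_norm).pow_const _).aestronglyMeasurable
  · rw [Real.norm_of_nonneg (by positivity)]
    have h1 : (1 + ‖z‖) / 2 ≤ max 1 ‖z‖ := by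
      rcases le_total 1 ‖z‖ with h | h
      · rw [max_eq_right h]; linarith
      · rw [max_eq_left h]; linarith
    calc (max 1 ‖z‖) ^ (-(2 * n + 1 : ℝ)) ≤ ((1 + ‖z‖) / 2) ^ (-(2 * n + 1 : ℝ)) :=
          Real.rpow_le_rpow_of_nonpos (by positivity) h1 (by linarith [Nat.cast_nonneg (α := ℝ) n])
      _ = _ := by
          rw [Real.div_rpow (by positivity) (by positivity), Real.rpow_neg (by norm_num : (0:ℝ) ≤ 2)]
          field_simp

theorem integrable_of_wnorm {w : Sp n → ℝ} (hw : Continuous w)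
    (hfin : wnorm 0 (2 * n + 1) w ≠ ⊤) : Integrable w :=
  (integrable_max_norm_rpow.const_mul _).mono' hw.aestronglyMeasurable
    (Eventually.of_forall fun z => abs_le_wnorm hfin z)

theorem integral_abs_le_wnorm {w : Sp n → ℝ} (hw : Continuous w)
    (hfin : wnorm 0 (2 * n + 1) w ≠ ⊤) :
    ∫ z, |w z| ≤ (wnorm 0 (2 * n + 1) w).toReal *
      ∫ z : Sp n, (max 1 ‖z‖) ^ (-(2 * n + 1 : ℝ)) := by
  rw [← integral_const_mul]
  exact integral_mono (integrable_of_wnorm hw hfin).abs (integrable_max_norm_rpow.const_mul _)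
    fun z => abs_le_wnorm hfin z

theorem integrable_wt_mul_max {p : ℕ} (hn : 2 ≤ n) (hp : 1 ≤ p) (i : Fin n) :
    Integrable fun u : Sp' n i => wt p i u * (max 1 ‖u‖) ^ (-(2 * n - 1 : ℝ)) := by
  have h := integrable_weight (p := p) (a := 0) (by omega) le_rfl
    (by have : (1 : ℝ) ≤ p := by exact_mod_cast hp
        linarith)
    (by have : (2 : ℝ) ≤ n := by exact_mod_cast hn
        linarith) i
  simpa using h

theorem abs_wt_mul_chart_le (p : ℕ) (i : Fin n) (t : ℝ) {w : Sp n → ℝ} {D : ℝ} (hn : 1 ≤ n)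
    (hD : ∀ z, |w z| ≤ D * (max 1 ‖z‖) ^ (-(2 * n - 1 : ℝ))) (u : Sp' n i) :
    |wt p i u * w (chart i t u)| ≤ D * (wt p i u * (max 1 ‖u‖) ^ (-(2 * n - 1 : ℝ))) := by
  have hD0 : 0 ≤ D := by
    have := (abs_nonneg _).trans (hD 0)
    simpa using this
  have hn' : (1 : ℝ) ≤ n := by exact_mod_cast hn
  have hb := max_norm_ins_rpow_le i u (height i t u) (b := 2 * n - 1) (by linarith)
  have h1 : |w (chart i t u)| ≤ D * (max 1 ‖u‖) ^ (-(2 * n - 1 : ℝ)) :=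
    (hD _).trans (mul_le_mul_of_nonneg_left hb hD0)
  rw [abs_mul, abs_of_nonneg (wt_nonneg p i u), mul_left_comm]
  exact mul_le_mul_of_nonneg_left h1 (wt_nonneg p i u)

theorem integrable_wt_mul_chart {p : ℕ} (hn : 2 ≤ n) (hp : 1 ≤ p) (i : Fin n) (t : ℝ)
    {w : Sp n → ℝ} (hw : Measurable w) {D : ℝ}
    (hD : ∀ z, |w z| ≤ D * (max 1 ‖z‖) ^ (-(2 * n - 1 : ℝ))) :
    Integrable fun u => wt p i u * w (chart i t u) :=
  ((integrable_wt_mul_max hn hp i).const_mul D).mono'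
    ((measurable_wt p i).mul (hw.comp (measurable_chart_right i t))).aestronglyMeasurable
    (Eventually.of_forall fun u => abs_wt_mul_chart_le p i t (by omega) hD u)

theorem abs_sigmaInf_le (hn : 2 ≤ n) :
    ∃ K : ℝ, 0 ≤ K ∧ ∀ (t : ℝ) (w : Sp n → ℝ), Measurable w → ∀ D : ℝ,
      (∀ z, |w z| ≤ D * (max 1 ‖z‖) ^ (-(2 * n - 1 : ℝ))) → |sigmaInf n w t| ≤ K * D := by
  refine ⟨∑ i : Fin n, ∫ u : Sp' n i, wt 1 i u * (max 1 ‖u‖) ^ (-(2 * n - 1 : ℝ)),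
    Finset.sum_nonneg fun i _ => integral_nonneg fun u => ?_, fun t w hw D hD => ?_⟩
  · exact mul_nonneg (wt_nonneg _ _ _) (by positivity)
  have hint := fun i => integrable_wt_mul_chart hn le_rfl i t hw hD
  rw [sigmaInf_eq_sum hn one_ne_zero t hw hint, Finset.sum_mul]
  refine (Finset.abs_sum_le_sum_abs _ _).trans (Finset.sum_le_sum fun i _ => ?_)
  rw [mul_comm, ← integral_const_mul]
  exact abs_integral_le_integral_abs.trans (integral_mono (hint i).abs
    ((integrable_wt_mul_max hn le_rfl i).const_mul D)
    fun u => abs_wt_mul_chart_le 1 i t (by omega) hD u)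

/-! ### Comparison with the singular integral. -/

/-- The normalised integral `∫ w(z) h(X, F₀(z) - m) dz`. -/
def deltaIntegral (w : Sp n → ℝ) (m X : ℝ) : ℝ := ∫ z, w z * hFun X (F0 z - m)

theorem integrable_mul_hFun {w : Sp n → ℝ} (hw : Integrable w) (m : ℝ) {X : ℝ} (hX : 0 < X) :
    Integrable fun z => w z * hFun X (F0 z - m) := by
  obtain ⟨K, -, hK⟩ := exists_hFun_le X hX
  refine hw.mul_bdd (c := K / X) ?_ (Eventually.of_forall fun z => hK X _ hX le_rfl)
  exact ((continuous_hFun hX).comp (contDiff_F0.continuous.sub continuous_const)).aestronglyMeasurable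

theorem exists_abs_deltaIntegral_le (n : ℕ) {C : ℝ} (hC : 0 < C) :
    ∃ K : ℝ, 0 ≤ K ∧ ∀ (m X : ℝ), 0 < X → X ≤ C → ∀ w : Sp n → ℝ, Continuous w →
      wnorm 0 (2 * n + 1) w ≠ ⊤ →
      |deltaIntegral w m X| ≤ K / X * (wnorm 0 (2 * n + 1) w).toReal := by
  obtain ⟨K, hK0, hK⟩ := exists_hFun_le C hC
  have hI : 0 ≤ ∫ z : Sp n, (max 1 ‖z‖) ^ (-(2 * n + 1 : ℝ)) :=
    integral_nonneg fun z => by positivity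
  refine ⟨K * ∫ z : Sp n, (max 1 ‖z‖) ^ (-(2 * n + 1 : ℝ)), by positivity,
    fun m X hX hXC w hw hfin => ?_⟩
  have hwi := integrable_of_wnorm hw hfin
  calc |deltaIntegral w m X| ≤ ∫ z, |w z * hFun X (F0 z - m)| := abs_integral_le_integral_abs
    _ ≤ ∫ z, K / X * |w z| := by
      refine integral_mono (integrable_mul_hFun hwi m hX).abs (hwi.abs.const_mul _) fun z => ?_
      simp only
      rw [abs_mul, mul_comm]
      exact mul_le_mul_of_nonneg_right (hK X _ hX hXC) (abs_nonneg _)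
    _ = K / X * ∫ z, |w z| := integral_const_mul _ _
    _ ≤ K / X * ((wnorm 0 (2 * n + 1) w).toReal *
          ∫ z : Sp n, (max 1 ‖z‖) ^ (-(2 * n + 1 : ℝ))) :=
      mul_le_mul_of_nonneg_left (integral_abs_le_wnorm hw hfin) (by positivity)
    _ = _ := by ring

/-- The integral against `h(X, F₀ - m)` approximates the singular integral. -/
theorem exists_abs_deltaIntegral_sub_sigmaInf_le {M : ℕ} (hMn : M + 2 ≤ n) {C p : ℝ} (hC : 0 < C)
    (hp1 : (M : ℝ) ≤ p) (hp2 : p < M + 1) :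
    ∃ K : ℝ, 0 ≤ K ∧ ∀ (m X : ℝ), 0 < X → X ≤ C → ∀ w : Sp n → ℝ, ContDiff ℝ (M + 1 : ℕ) w →
      wnorm (M + 1) (2 * n - 1) w ≠ ⊤ → wnorm 0 (2 * n + 1) w ≠ ⊤ →
      |deltaIntegral w m X - sigmaInf n w m| ≤
        K * (X ^ p * (wnorm (M + 1) (2 * n - 1) w).toReal +
          X ^ (M + 1) * (wnorm 0 (2 * n + 1) w).toReal) := by
  have hn : 2 ≤ n := by omega
  have hn' : (2 : ℝ) ≤ n := by exact_mod_cast hn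
  have hMn' : (M : ℝ) + 2 ≤ n := by exact_mod_cast hMn
  have hp0 : 0 ≤ p := (Nat.cast_nonneg M).trans hp1
  obtain ⟨K, hK0, hK⟩ := exists_kernel_bound M hC hp1 hp2.le
  -- `integrable_weight` requires `p ≤ P - 1`; since `p < M + 1`, the choice `M + 2` suffices.
  set P : ℕ := M + 2 with hP
  have hP0 : P ≠ 0 := by omega
  set b : ℝ := 2 * n - 1 with hb
  set W₀ : Fin n → ℝ := fun i => ∫ u : Sp' n i, wt P i u * (max 1 ‖u‖) ^ (-b) with hW₀
  set W₁ : Fin n → ℝ := fun i =>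
    ∫ u : Sp' n i, wt P i u * |xc i u| ^ (-p) * (max 1 ‖u‖) ^ (-b) with hW₁
  set I := ∫ z : Sp n, (max 1 ‖z‖) ^ (-(2 * n + 1 : ℝ)) with hI
  have hI0 : 0 ≤ I := integral_nonneg fun z => by positivity
  have hW₀0 : ∀ i, 0 ≤ W₀ i := fun i =>
    integral_nonneg fun u => mul_nonneg (wt_nonneg _ _ _) (by positivity)
  have hW₁0 : ∀ i, 0 ≤ W₁ i := fun i => integral_nonneg fun u =>
    mul_nonneg (mul_nonneg (wt_nonneg _ _ _) (by positivity)) (by positivity)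
  refine ⟨∑ i, K * (W₀ i + W₁ i + I), Finset.sum_nonneg fun i _ =>
    mul_nonneg hK0 (by linarith [hW₀0 i, hW₁0 i]), fun m X hX hXC w hw hfin hfin0 => ?_⟩
  set N₁ := (wnorm (M + 1) b w).toReal with hN₁
  set N₀ := (wnorm 0 (2 * n + 1) w).toReal with hN₀
  have hN₁0 : 0 ≤ N₁ := ENNReal.toReal_nonneg
  have hN₀0 : 0 ≤ N₀ := ENNReal.toReal_nonneg
  have hwc := hw.continuous
  have hwi := integrable_of_wnorm hwc hfin0
  have hwD : ∀ z, |w z| ≤ N₁ * (max 1 ‖z‖) ^ (-b) := fun z => abs_le_wnorm hfin z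
  have hF := integrable_mul_hFun hwi m hX
  have hσi := fun i => integrable_wt_mul_chart (p := P) hn (by omega) i m hwc.measurable hwD
  have hFi := fun i => integrable_and_integral_rho hP0 hF i m
  have hwa := fun i => integrable_and_integral_rho hP0 hwi.abs i m
  rw [deltaIntegral, integral_eq_sum_chart (by omega) hP0 hF m,
    sigmaInf_eq_sum hn hP0 m hwc.measurable hσi, ← Finset.sum_sub_distrib, Finset.sum_mul]
  refine (Finset.abs_sum_le_sum_abs _ _).trans (Finset.sum_le_sum fun i _ => ?_)
  rw [← integral_sub (hFi i).1 (hσi i)]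
  have hw0 := integrable_wt_mul_max (p := P) hn (by omega) i
  have hw1 := integrable_weight (p := P) (a := p) (by omega) hp0
    (by rw [hP]; push_cast; linarith) (by linarith) i
  set maj : Sp' n i → ℝ := fun u => K * (X ^ p * N₁ * (wt P i u * (max 1 ‖u‖) ^ (-b) +
    wt P i u * |xc i u| ^ (-p) * (max 1 ‖u‖) ^ (-b)) +
    X ^ (M + 1) * (wt P i u * ∫ r, |w (chart i (m + r) u)|)) with hmaj
  have hmaji : Integrable maj :=
    (((hw0.add hw1).const_mul _).add ((hwa i).1.const_mul _)).const_mul _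
  have hpt : ∀ᵐ u : Sp' n i, |wt P i u * (∫ r, w (chart i (m + r) u) *
      hFun X (F0 (chart i (m + r) u) - m)) - wt P i u * w (chart i m u)| ≤ maj u := by
    filter_upwards [ae_integrable_chart hwi i m] with u hu
    by_cases hud : u ∈ chartDom i
    · have hx : 0 < |xc i u| := abs_pos.2 hud
      -- The kernel bound on one fibre, with `A = |x i|⁻¹` and `B` carrying the decay in `u`.
      -- Integrated over `u`, the term `A^p` produces the singular weight `|x i|^(-p)`.
      have h1 := hK X hX hXC (fun r => w (chart i (m + r) u)) (contDiff_comp_chart hw i m u)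
        (hu hud) |xc i u|⁻¹ (N₁ * (max 1 ‖u‖) ^ (-b)) (inv_pos.2 hx) fun k hk s =>
          abs_iteratedDeriv_comp_chart_le (by linarith) hw hfin hk i m u s
      have h2 : ∀ r, w (chart i (m + r) u) * hFun X (F0 (chart i (m + r) u) - m) =
          hFun X r * w (chart i (m + r) u) := by
        intro r
        rw [F0_chart hud, add_sub_cancel_left, mul_comm]
      simp only [h2, add_zero] at h1 ⊢
      rw [← mul_sub, abs_mul, abs_of_nonneg (wt_nonneg P i u)]
      refine (mul_le_mul_of_nonneg_left h1 (wt_nonneg P i u)).trans_eq ?_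
      rw [hmaj, Real.inv_rpow hx.le, ← Real.rpow_neg hx.le]
      ring
    · have h0 : wt P i u = 0 := wt_eq_zero hud
      simp only [hmaj, h0, zero_mul, sub_self, abs_zero, mul_zero, add_zero, le_refl]
  calc |∫ u, (wt P i u * (∫ r, w (chart i (m + r) u) *
        hFun X (F0 (chart i (m + r) u) - m)) - wt P i u * w (chart i m u))|
      ≤ ∫ u, maj u := by
        refine abs_integral_le_integral_abs.trans ?_
        exact integral_mono_ae ((hFi i).1.sub (hσi i)).abs hmaji hpt
    _ = K * (X ^ p * N₁ * (W₀ i + W₁ i) + X ^ (M + 1) * ∫ z, rho P i z * |w z|) := by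
        rw [hmaj, integral_const_mul, integral_add, integral_const_mul, integral_add hw0 hw1,
          integral_const_mul, (hwa i).2]
        · exact (hw0.add hw1).const_mul _
        · exact (hwa i).1.const_mul _
    _ ≤ K * (X ^ p * N₁ * (W₀ i + W₁ i) + X ^ (M + 1) * (N₀ * I)) := by
        gcongr
        refine le_trans ?_ (integral_abs_le_wnorm hwc hfin0)
        refine integral_mono_of_nonneg (Eventually.of_forall fun z =>
          mul_nonneg (rho_nonneg _ _ _) (abs_nonneg _)) hwi.abs (Eventually.of_forall fun z => ?_)
        exact mul_le_of_le_one_left (abs_nonneg _) (rho_le_one _ _ _)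
    _ ≤ _ := by
        have e1 : 0 ≤ X ^ p * N₁ * I := by positivity
        have e2 : 0 ≤ X ^ (M + 1) * N₀ * (W₀ i + W₁ i) :=
          mul_nonneg (by positivity) (add_nonneg (hW₀0 i) (hW₁0 i))
        rw [mul_assoc K]
        refine mul_le_mul_of_nonneg_left ?_ hK0
        linarith

/-! ### Rescaling and the final estimates. -/

/-- The oscillating factor is `1` at `c = 0`, and `F0` is homogeneous of degree two, so the
substitution `z ↦ L z` leaves only the Jacobian `L^d`. -/
theorem Iq_zero_eq (w : Sp n → ℝ) (m : ℝ) {L : ℝ} (hL : 0 < L) (q : ℕ) :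
    Iq w m L q 0 = ((L ^ (2 * n) * deltaIntegral w m (q / L) : ℝ) : ℂ) := by
  have h1 : ∀ z : Sp n, F0 (L⁻¹ • z) - m = (F0 z - m * L ^ 2) / L ^ 2 := by
    intro z
    have : F0 (L⁻¹ • z) = (L⁻¹) ^ 2 * F0 z := by
      simp only [F0, PiLp.smul_apply, smul_eq_mul, Finset.mul_sum]
      exact Finset.sum_congr rfl fun j _ => by ring
    rw [this]; field_simp
  have h2 := Measure.integral_comp_smul (volume : Measure (Sp n))
    (fun z => w z * hFun (q / L) (F0 z - m)) L⁻¹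
  rw [finrank_euclideanSpace, Fintype.card_sum, Fintype.card_fin, inv_pow, inv_inv,
    abs_of_pos (by positivity), ← two_mul, smul_eq_mul] at h2
  rw [deltaIntegral, ← h2, Iq, ← integral_complex_ofReal]
  refine integral_congr_ae (Eventually.of_forall fun z => ?_)
  simp [expQ, h1]

theorem norm_Iq_sub (w : Sp n → ℝ) (m : ℝ) {L : ℝ} (hL : 0 < L) (q : ℕ) :
    ‖Iq w m L q 0 - ((L ^ (2 * n) * sigmaInf n w m : ℝ) : ℂ)‖ =
      L ^ (2 * n) * |deltaIntegral w m (q / L) - sigmaInf n w m| := by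
  rw [Iq_zero_eq w m hL, ← Complex.ofReal_sub, Complex.norm_real, ← mul_sub, norm_mul,
    Real.norm_eq_abs, Real.norm_eq_abs, abs_of_pos (by positivity)]

theorem pow_mul_rpow_eq (n M : ℕ) (γ : ℝ) {L : ℝ} (hL : 0 < L) (q : ℕ) :
    (q : ℝ) ^ M * L ^ (2 * n - M + γ : ℝ) = L ^ (2 * n) * ((q / L) ^ M * L ^ γ) := by
  rw [Real.rpow_add hL, Real.rpow_sub hL, Real.rpow_natCast, div_pow,
    show (2 * n : ℝ) = ((2 * n : ℕ) : ℝ) by push_cast; ring, Real.rpow_natCast]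
  field_simp

/-- Fractional order `M - γ` with `γ > 0` satisfies `1 + (M - γ) < n` even at the endpoint `M = n -
1`. The loss `X^(-γ)` is at most `L^γ` because `q ≥ 1`, so no logarithm appears. -/
theorem exists_norm_Iq_sub_le {M : ℕ} (hM : 1 ≤ M) (hMn : M + 1 ≤ n) {C γ₁ : ℝ} (hC : 0 < C)
    (hγ : 0 < γ₁) :
    ∃ K : ℝ, 0 ≤ K ∧ ∀ (m : ℝ) (w : Sp n → ℝ), ContDiff ℝ M w →
      wnorm M (2 * n - 1) w ≠ ⊤ → wnorm 0 (2 * n + 1) w ≠ ⊤ →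
      ∀ L : ℝ, 1 < L → ∀ q : ℕ, 1 ≤ q → (q : ℝ) ≤ C * L →
        ‖Iq w m L q 0 - ((L ^ (2 * n) * sigmaInf n w m : ℝ) : ℂ)‖ ≤
          K * ((q : ℝ) ^ M * L ^ (2 * n - M + γ₁ : ℝ) *
            ((wnorm M (2 * n - 1) w).toReal + (wnorm 0 (2 * n + 1) w).toReal)) := by
  obtain ⟨M, rfl⟩ : ∃ M', M = M' + 1 := ⟨M - 1, by omega⟩
  -- The cap at `1` keeps the order between the two consecutive integers allowed by the kernel
  -- bound.
  set γ := min γ₁ 1 with hγdef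
  have hγ0 : 0 < γ := lt_min hγ one_pos
  have hγ1 : γ ≤ 1 := min_le_right _ _
  have hγγ : γ ≤ γ₁ := min_le_left _ _
  obtain ⟨K, hK0, hK⟩ := exists_abs_deltaIntegral_sub_sigmaInf_le (n := n) (M := M) (by omega) hC
    (p := M + 1 - γ) (by linarith) (by linarith)
  refine ⟨K, hK0, fun m w hw hf1 hf0 L hL q hq hqL => ?_⟩
  have hL0 : 0 < L := by linarith
  have hq' : (1 : ℝ) ≤ q := by exact_mod_cast hq
  have hX : 0 < (q : ℝ) / L := by positivity
  have h1 := hK m (q / L) hX ((div_le_iff₀ hL0).2 hqL) w hw hf1 hf0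
  rw [norm_Iq_sub w m hL0, pow_mul_rpow_eq n _ γ₁ hL0]
  set X := (q : ℝ) / L with hXdef
  set N₁ := (wnorm (M + 1) (2 * n - 1) w).toReal
  set N₀ := (wnorm 0 (2 * n + 1) w).toReal
  have hN₁0 : 0 ≤ N₁ := ENNReal.toReal_nonneg
  have hN₀0 : 0 ≤ N₀ := ENNReal.toReal_nonneg
  have h2 : X ^ ((M : ℝ) + 1 - γ) ≤ X ^ (M + 1) * L ^ γ₁ := by
    have h3 : X ^ ((M : ℝ) + 1 - γ) = X ^ (M + 1) * X⁻¹ ^ γ := by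
      rw [Real.rpow_sub hX, Real.inv_rpow hX.le, ← Real.rpow_natCast X (M + 1)]
      push_cast
      rfl
    rw [h3]
    gcongr
    calc X⁻¹ ^ γ ≤ L ^ γ := by
          gcongr
          rw [hXdef, inv_div]
          exact div_le_self hL0.le hq'
      _ ≤ L ^ γ₁ := Real.rpow_le_rpow_of_exponent_le hL.le hγγ
  have h4 : X ^ (M + 1) ≤ X ^ (M + 1) * L ^ γ₁ :=
    le_mul_of_one_le_right (by positivity) (Real.one_le_rpow hL.le hγ.le)
  calc L ^ (2 * n) * |deltaIntegral w m X - sigmaInf n w m|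
      ≤ L ^ (2 * n) * (K * (X ^ ((M : ℝ) + 1 - γ) * N₁ + X ^ (M + 1) * N₀)) := by gcongr
    _ ≤ L ^ (2 * n) * (K * (X ^ (M + 1) * L ^ γ₁ * N₁ + X ^ (M + 1) * L ^ γ₁ * N₀)) := by gcongr
    _ = _ := by ring

/-- With `X` bounded below, `h` is bounded and no cancellation is needed: both terms are controlled
separately by the undifferentiated norm, and `X^M ≥ 2^(-M)` restores the required power. -/
theorem exists_norm_Iq_sub_le_of_half_lt {M : ℕ} (hn : 2 ≤ n) {C γ₁ : ℝ} (hC : 0 < C)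
    (hγ : 0 < γ₁) :
    ∃ K : ℝ, 0 ≤ K ∧ ∀ (m : ℝ) (w : Sp n → ℝ), Continuous w → wnorm 0 (2 * n + 1) w ≠ ⊤ →
      ∀ L : ℝ, 1 < L → ∀ q : ℕ, (q : ℝ) ≤ C * L → 1 / 2 < (q : ℝ) / L →
        ‖Iq w m L q 0 - ((L ^ (2 * n) * sigmaInf n w m : ℝ) : ℂ)‖ ≤
          K * ((q : ℝ) ^ M * L ^ (2 * n - M + γ₁ : ℝ) * (wnorm 0 (2 * n + 1) w).toReal) := by
  obtain ⟨K₁, hK₁0, hK₁⟩ := exists_abs_deltaIntegral_le n hC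
  obtain ⟨K₂, hK₂0, hK₂⟩ := abs_sigmaInf_le hn
  refine ⟨(2 * K₁ + K₂) * 2 ^ M, by positivity, fun m w hw hf0 L hL q hqL hX2 => ?_⟩
  have hL0 : 0 < L := by linarith
  rw [norm_Iq_sub w m hL0, pow_mul_rpow_eq n _ γ₁ hL0]
  have hXC : (q : ℝ) / L ≤ C := (div_le_iff₀ hL0).2 hqL
  set X := (q : ℝ) / L with hXdef
  have hX : 0 < X := by linarith
  set N₀ := (wnorm 0 (2 * n + 1) w).toReal
  have hN₀0 : 0 ≤ N₀ := ENNReal.toReal_nonneg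
  have h1 := hK₁ m X hX hXC w hw hf0
  have h2 := hK₂ m w hw.measurable N₀ fun z => (abs_le_wnorm hf0 z).trans
    (mul_le_mul_of_nonneg_left (Real.rpow_le_rpow_of_exponent_le (le_max_left _ _) (by linarith))
      hN₀0)
  have h3 : |deltaIntegral w m X - sigmaInf n w m| ≤ (2 * K₁ + K₂) * N₀ := by
    refine (abs_sub _ _).trans ((add_le_add h1 h2).trans ?_)
    have : K₁ / X ≤ 2 * K₁ := by
      rw [div_le_iff₀ hX]; nlinarith
    nlinarith
  have h4 : (1 : ℝ) ≤ 2 ^ M * (X ^ M * L ^ γ₁) := by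
    rw [← mul_assoc, ← mul_pow]
    exact one_le_mul_of_one_le_of_one_le (one_le_pow₀ (by linarith))
      (Real.one_le_rpow hL.le hγ.le)
  calc L ^ (2 * n) * |deltaIntegral w m X - sigmaInf n w m|
      ≤ L ^ (2 * n) * ((2 * K₁ + K₂) * N₀) := by gcongr
    _ ≤ L ^ (2 * n) * ((2 * K₁ + K₂) * N₀) * (2 ^ M * (X ^ M * L ^ γ₁)) :=
        le_mul_of_one_le_right (by positivity) h4
    _ = _ := by ring

end CircleMethod

end

/-! ### The three cases of the theorem. -/

theorem mainTheorem3 (n M : ℕ) (hM : 1 ≤ M) (C γ₁ R : ℝ) (hC : 0 < C) (hγ : 0 < γ₁) :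
    -- `d = 2 n`; the case `M < d/2 - 1`
    (M + 1 < n → ∃ K : ℝ, ∀ m : ℝ, |m| ≤ R → ∀ w : CircleMethod.Sp n → ℝ, ContDiff ℝ M w →
      CircleMethod.wnorm M (2 * n - 1) w ≠ ⊤ → CircleMethod.wnorm 0 (2 * n + 1) w ≠ ⊤ →
      ∀ L : ℝ, 1 < L → ∀ q : ℕ, 1 ≤ q → (q : ℝ) ≤ C * L →
        ‖CircleMethod.Iq w m L q 0 - ((L ^ (2 * n) * CircleMethod.sigmaInf n w m : ℝ) : ℂ)‖ ≤
          K * ((q : ℝ) ^ M * L ^ (2 * n - M + γ₁ : ℝ) *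
            ((CircleMethod.wnorm M (2 * n - 1) w).toReal + (CircleMethod.wnorm 0 (2 * n + 1) w).toReal))) ∧
    -- the borderline case `M = d/2 - 1`, `m ≠ 0`
    (M + 1 = n → ∃ K : ℝ, ∀ m : ℝ, |m| ≤ R → m ≠ 0 → ∀ w : CircleMethod.Sp n → ℝ, ContDiff ℝ M w →
      CircleMethod.wnorm M (2 * n - 1) w ≠ ⊤ → CircleMethod.wnorm 0 (2 * n + 1) w ≠ ⊤ →
      ∀ L : ℝ, 1 < L → ∀ q : ℕ, 1 ≤ q → (q : ℝ) ≤ C * L →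
        ‖CircleMethod.Iq w m L q 0 - ((L ^ (2 * n) * CircleMethod.sigmaInf n w m : ℝ) : ℂ)‖ ≤
          K * max 1 |Real.log (|m|)| * ((q : ℝ) ^ M * L ^ (2 * n - M + γ₁ : ℝ) *
            ((CircleMethod.wnorm M (2 * n - 1) w).toReal + (CircleMethod.wnorm 0 (2 * n + 1) w).toReal))) ∧
    -- the borderline case `M = d/2 - 1`, `m = 0`
    (M + 1 = n → ∃ K : ℝ, ∀ w : CircleMethod.Sp n → ℝ, ContDiff ℝ M w →
      CircleMethod.wnorm M (2 * n - 1) w ≠ ⊤ → CircleMethod.wnorm 0 (2 * n + 1) w ≠ ⊤ →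
      ∀ L : ℝ, 1 < L → ∀ q : ℕ, 1 ≤ q → (q : ℝ) ≤ C * L →
        ‖CircleMethod.Iq w 0 L q 0 - ((L ^ (2 * n) * CircleMethod.sigmaInf n w 0 : ℝ) : ℂ)‖ ≤
          K * ((q : ℝ) ^ M * L ^ (2 * n - M + γ₁ : ℝ) *
            ((CircleMethod.wnorm M (2 * n - 1) w).toReal * |Real.log (q / L)| +
              (CircleMethod.wnorm 0 (2 * n + 1) w).toReal))) := by
  refine ⟨fun hMn => ?_, fun hMn => ?_, fun hMn => ?_⟩
  · obtain ⟨K, -, hK⟩ := CircleMethod.exists_norm_Iq_sub_le (n := n) hM (by omega) hC hγ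
    exact ⟨K, fun m _ => hK m⟩
  · obtain ⟨K, hK0, hK⟩ := CircleMethod.exists_norm_Iq_sub_le (n := n) hM (by omega) hC hγ
    refine ⟨K, fun m _ _ w hw hf1 hf0 L hL q hq hqL => (hK m w hw hf1 hf0 L hL q hq hqL).trans ?_⟩
    have hL0 : 0 < L := by linarith
    -- The factor `max 1 |log |m||` is at least `1`, so it only weakens the estimate free of
    -- logarithms.
    refine mul_le_mul_of_nonneg_right (le_mul_of_one_le_right hK0 (le_max_left _ _)) ?_
    exact mul_nonneg (by positivity) (add_nonneg ENNReal.toReal_nonneg ENNReal.toReal_nonneg)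
  · obtain ⟨K₁, hK₁0, hK₁⟩ := CircleMethod.exists_norm_Iq_sub_le (n := n) hM (by omega) hC hγ
    obtain ⟨K₂, hK₂0, hK₂⟩ :=
      CircleMethod.exists_norm_Iq_sub_le_of_half_lt (n := n) (M := M) (by omega) hC hγ
    have hlog2 : 0 < Real.log 2 := Real.log_pos one_lt_two
    refine ⟨K₁ * (1 + (Real.log 2)⁻¹) + K₂, fun w hw hf1 hf0 L hL q hq hqL => ?_⟩
    have hL0 : 0 < L := by linarith
    have hq0 : (0 : ℝ) < q := by exact_mod_cast hq
    set T : ℝ := (q : ℝ) ^ M * L ^ (2 * n - M + γ₁ : ℝ)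
    have hT : 0 ≤ T := by positivity
    set N₁ := (CircleMethod.wnorm M (2 * n - 1) w).toReal
    set N₀ := (CircleMethod.wnorm 0 (2 * n + 1) w).toReal
    have hN₁0 : 0 ≤ N₁ := ENNReal.toReal_nonneg
    have hN₀0 : 0 ≤ N₀ := ENNReal.toReal_nonneg
    set ℓ := |Real.log (q / L)|
    have hℓ0 : 0 ≤ ℓ := abs_nonneg _
    -- `|log (q / L)|` vanishes at `q = L`, so for `q / L > 1 / 2` the bound must avoid the
    -- differentiated norm. For `q / L ≤ 1 / 2` the logarithm is at least `log 2` in absolute value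
    -- and can be inserted at the cost of a constant.
    rcases lt_or_ge (1 / 2) ((q : ℝ) / L) with h | h
    · refine (hK₂ 0 w hw.continuous hf0 L hL q hqL h).trans ?_
      have h1 : T * N₀ ≤ T * (N₁ * ℓ + N₀) := by
        gcongr; linarith [mul_nonneg hN₁0 hℓ0]
      refine mul_le_mul ?_ h1 (by positivity) (by positivity)
      linarith [show 0 ≤ K₁ * (1 + (Real.log 2)⁻¹) by positivity]
    · refine (hK₁ 0 w hw hf1 hf0 L hL q hq hqL).trans ?_
      have hlog : Real.log 2 ≤ ℓ := by
        have h2 : Real.log (q / L) ≤ -Real.log 2 := by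
          rw [← Real.log_inv]
          exact Real.log_le_log (by positivity) (by rwa [one_div] at h)
        exact le_trans (by linarith) (neg_le_abs _)
      have h3 : N₁ + N₀ ≤ (1 + (Real.log 2)⁻¹) * (N₁ * ℓ + N₀) := by
        have h4 : N₁ ≤ (Real.log 2)⁻¹ * (N₁ * ℓ) := by
          rw [inv_mul_eq_div, le_div_iff₀ hlog2]
          exact mul_le_mul_of_nonneg_left hlog hN₁0
        have h5 : 0 ≤ N₁ * ℓ := by positivity
        have h6 : 0 ≤ (Real.log 2)⁻¹ * N₀ := by positivity
        linarith
      calc K₁ * (T * (N₁ + N₀))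
          ≤ K₁ * (T * ((1 + (Real.log 2)⁻¹) * (N₁ * ℓ + N₀))) := by gcongr
        _ = K₁ * (1 + (Real.log 2)⁻¹) * (T * (N₁ * ℓ + N₀)) := by ring
        _ ≤ _ := by gcongr; linarith
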